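/- **Theorem 3.4.** Let $t>0$. For $\lambda\neq 0$ let $H(\lambda)=-\Delta+\lambda^2|x|^2$ be the scaled Hermite operator on $\mathbb R^d$ (here $d=n$ or $d=2n$), with orthonormal basis of eigenfunctions $\Phi_\alpha^\lambda(x)=|\lambda|^{d/4}\Phi_\alpha(|\lambda|^{1/2}x)$, $\alpha\in\mathbb N^d$, where $\Phi_\alpha$ are the normalized Hermite functions, and eigenvalues $(2|\alpha|+d)|\lambda|$. Let $$e^{-t\sqrt{H(\lambda)}}g=\sum_{\alpha\in\mathbb N^d}e^{-t\sqrt{(2|\alpha|+d)|\lambda|}}\,(g,\Phi_\alpha^\lambda)\,\Phi_\alpha^\lambda,\qquad \mathcal M_{t,\lambda}^\omega(\mathbb R^d)=e^{-t\sqrt{H(\lambda)}}\bigl(L^2(\mathbb R^d)\bigr),\qquad \mathcal M_t^\omega=\mathcal M_{t,1}^\omega(\mathbb R^n).$$ For $x,u\in\mathbb R^n$ and $\varphi\in L^2(\mathbb R^n)$ let $(\pi(x,u)\varphi)(\xi)=e^{i(x\cdot\xi+\frac12x\cdot u)}\varphi(\xi+u)$, and let the Weyl transform of a function $F$ on $\mathbb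 R^{2n}$ be $$W(F)\varphi=\int_{\mathbb R^{2n}}F(x,u)\,\pi(x,u)\varphi\,dx\,du .$$ For every $F\in\mathcal M_{\sqrt2t,1/2}^\omega(\mathbb R^{2n})$ and every $\varphi\in L^2(\mathbb R^n)$ this integral converges absolutely in $L^2(\mathbb R^n)$ (as a Bochner integral), and $$\bigl\{W(F)\varphi : F\in\mathcal M_{\sqrt2t,1/2}^\omega(\mathbb R^{2n}),\ \varphi\in L^2(\mathbb R^n)\bigr\}=\mathcal M_t^\omega .$$ -/

import Mathlib

open MeasureTheory
noncomputable section

/-- The complex Hilbert space `L²(ℝ^ι)` with respect to Lebesgue measure. -/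
abbrev L2 (ι : Type) [Fintype ι] : Type :=
  Lp ℂ 2 (volume : Measure (EuclideanSpace ℝ ι))

/-- The normalised Hermite function `h_k` on `ℝ`,
`h_k(x) = (√π 2^k k!)^{-1/2} H_k(x) e^{-x²/2}` with `H_k` the physicists' Hermite polynomial.
Since `Polynomial.hermite k` is the probabilists' polynomial `He_k` and
`H_k(x) = 2^{k/2} He_k(√2 x)`, this is `(√π k!)^{-1/2} He_k(√2 x) e^{-x²/2}`. -/
def hermiteFun (k : ℕ) (x : ℝ) : ℝ :=
  (Real.sqrt (Real.sqrt Real.pi * (k.factorial : ℝ)))⁻¹ *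
    Polynomial.aeval (Real.sqrt 2 * x) (Polynomial.hermite k) * Real.exp (-(x ^ 2 / 2))

/-- The scaled Hermite function on `ℝ^ι`, with `ι` of cardinality `d`:
`Φ_α^λ(x) = |λ|^{d/4} Φ_α(|λ|^{1/2} x)`, where `Φ_α(x) = ∏ i, h_{α i}(x i)`. -/
def scaledHermite {ι : Type} [Fintype ι] (lam : ℝ) (α : ι → ℕ) (x : EuclideanSpace ℝ ι) : ℝ :=
  |lam| ^ ((Fintype.card ι : ℝ) / 4) * ∏ i, hermiteFun (α i) (Real.sqrt |lam| * x i)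

/-- The eigenvalue `(2|α| + d)|λ|` of the scaled Hermite operator `H(λ)` on `ℝ^ι`, `d = card ι`,
belonging to the eigenfunction `Φ_α^λ`; see `hermiteOp_scaledHermite`. -/
def hermiteEigenvalue {ι : Type} [Fintype ι] (lam : ℝ) (α : ι → ℕ) : ℝ :=
  (2 * ∑ i, (α i : ℝ) + (Fintype.card ι : ℝ)) * |lam|

/-- The scaled Hermite operator `H(λ) f = -Δ f + λ² |x|² f` on `ℝ^ι`. -/
def hermiteOp {ι : Type} [Fintype ι] (lam : ℝ) (f : EuclideanSpace ℝ ι → ℝ)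
    (x : EuclideanSpace ℝ ι) : ℝ :=
  -(Laplacian.laplacian f x) + lam ^ 2 * ‖x‖ ^ 2 * f x

theorem derivative_hermite_succ (k : ℕ) :
    Polynomial.derivative (Polynomial.hermite (k + 1)) =
      ((k : Polynomial ℤ) + 1) * Polynomial.hermite k := by
  induction k with
  | zero => simp [Polynomial.hermite_succ]
  | succ k ih =>
    rw [Polynomial.hermite_succ (k + 1), Polynomial.derivative_sub, Polynomial.derivative_mul, ih,
      Polynomial.derivative_mul]
    rw [show Polynomial.derivative (Polynomial.hermite k) =
      Polynomial.X * Polynomial.hermite k - Polynomial.hermite (k + 1) by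
        rw [Polynomial.hermite_succ]; ring]
    simp
    ring

theorem hermite_ode (k : ℕ) :
    Polynomial.derivative (Polynomial.derivative (Polynomial.hermite k)) =
      Polynomial.X * Polynomial.derivative (Polynomial.hermite k) -
        (k : Polynomial ℤ) * Polynomial.hermite k := by
  have h := derivative_hermite_succ k
  rw [Polynomial.hermite_succ, Polynomial.derivative_sub, Polynomial.derivative_mul] at h
  simp at h
  linear_combination -h

theorem hasDerivAt_aeval_mul_exp (p : Polynomial ℤ) (c x : ℝ) :
    HasDerivAt (fun y : ℝ => c * Polynomial.aeval (Real.sqrt 2 * y) p * Real.exp (-(y ^ 2 / 2)))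
      (c * (Real.sqrt 2 * Polynomial.aeval (Real.sqrt 2 * x) (Polynomial.derivative p)
          - x * Polynomial.aeval (Real.sqrt 2 * x) p) * Real.exp (-(x ^ 2 / 2))) x := by
  have h1 : HasDerivAt (fun y : ℝ => Polynomial.aeval (Real.sqrt 2 * y) p)
      (Polynomial.aeval (Real.sqrt 2 * x) (Polynomial.derivative p) * (Real.sqrt 2 * 1)) x :=
    HasDerivAt.comp x (p.hasDerivAt_aeval (Real.sqrt 2 * x))
      ((hasDerivAt_id x).const_mul (Real.sqrt 2))
  have h2 : HasDerivAt (fun y : ℝ => Real.exp (-(y ^ 2 / 2)))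
      (Real.exp (-(x ^ 2 / 2)) * -(((2 : ℕ) * x ^ (2 - 1) * 1) / 2)) x :=
    ((((hasDerivAt_id x).pow 2).div_const 2).neg).exp
  refine ((h1.const_mul c).mul h2).congr_deriv ?_
  push_cast
  ring

theorem contDiff_hermiteFun (k : ℕ) {m : WithTop ℕ∞} : ContDiff ℝ m (hermiteFun k) := by
  unfold hermiteFun
  have : ContDiff ℝ m (fun x : ℝ => Polynomial.aeval (Real.sqrt 2 * x) (Polynomial.hermite k)) :=
    (Polynomial.contDiff_aeval _ _).comp (contDiff_const.mul contDiff_id)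
  fun_prop

/-- The one-dimensional eigenvalue equation `h_k'' = (x² - (2k+1)) h_k`. -/
theorem deriv_deriv_hermiteFun (k : ℕ) (x : ℝ) :
    deriv (deriv (hermiteFun k)) x = (x ^ 2 - (2 * k + 1)) * hermiteFun k x := by
  set c := (Real.sqrt (Real.sqrt Real.pi * (k.factorial : ℝ)))⁻¹ with hc
  have hd : deriv (hermiteFun k) = fun y =>
      (c * Real.sqrt 2) * Polynomial.aeval (Real.sqrt 2 * y)
        (Polynomial.derivative (Polynomial.hermite k)) * Real.exp (-(y ^ 2 / 2))
        - y * hermiteFun k y := by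
    funext y
    refine ((hasDerivAt_aeval_mul_exp (Polynomial.hermite k) c y).deriv).trans ?_
    simp only [hermiteFun, ← hc]
    ring
  have hk := (hasDerivAt_aeval_mul_exp (Polynomial.hermite k) c x)
  have hk' : HasDerivAt (hermiteFun k) _ x := hk
  rw [hd, ((hasDerivAt_aeval_mul_exp _ (c * Real.sqrt 2) x).fun_sub
    ((hasDerivAt_id' x).fun_mul hk')).deriv, hermite_ode]
  simp only [hermiteFun, ← hc, map_sub, map_mul, Polynomial.aeval_X, map_natCast]
  have h2 : Real.sqrt 2 * Real.sqrt 2 = 2 := Real.mul_self_sqrt (by norm_num)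
  linear_combination (c * Real.exp (-(x ^ 2 / 2)) * (Real.sqrt 2 * x *
    Polynomial.aeval (Real.sqrt 2 * x) (Polynomial.derivative (Polynomial.hermite k)) -
    k * Polynomial.aeval (Real.sqrt 2 * x) (Polynomial.hermite k))) * h2

theorem contDiff_scaledHermite {ι : Type} [Fintype ι] (lam : ℝ) (α : ι → ℕ)
    {m : WithTop ℕ∞} : ContDiff ℝ m (scaledHermite lam α) := by
  unfold scaledHermite
  refine contDiff_const.mul (contDiff_prod fun i _ => (contDiff_hermiteFun _).comp ?_)
  fun_prop

theorem secondDeriv_scaledHermite {ι : Type} [Fintype ι] [DecidableEq ι] (lam : ℝ) (α : ι → ℕ)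
    (x : EuclideanSpace ℝ ι) (i : ι) :
    iteratedFDeriv ℝ 2 (scaledHermite lam α) x
      ![EuclideanSpace.single i 1, EuclideanSpace.single i 1] =
    (lam ^ 2 * x i ^ 2 - (2 * α i + 1) * |lam|) * scaledHermite lam α x := by
  set v : EuclideanSpace ℝ ι := EuclideanSpace.single i 1 with hv
  set f := scaledHermite lam α with hf
  have hC : ContDiff ℝ 2 f := contDiff_scaledHermite lam α
  have hdf : Differentiable ℝ f := hC.differentiable (by norm_num)
  have hdf' : Differentiable ℝ (fderiv ℝ f) :=
    (hC.fderiv_right (m := 1) (by norm_num)).differentiable (by norm_num)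
  have hline : ∀ s : ℝ, HasDerivAt (fun s : ℝ => x + s • v) v s := fun s => by
    simpa using ((hasDerivAt_id' s).smul_const v).const_add x
  have h1 : deriv (fun s : ℝ => f (x + s • v)) = fun s => fderiv ℝ f (x + s • v) v := by
    funext s
    exact ((hdf _).hasFDerivAt.comp_hasDerivAt s (hline s)).deriv
  have h2 : deriv (fun s : ℝ => fderiv ℝ f (x + s • v) v) 0 = fderiv ℝ (fderiv ℝ f) x v v := by
    have := ((hdf' (x + (0 : ℝ) • v)).hasFDerivAt.comp_hasDerivAt (0 : ℝ) (hline 0))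
    have := (this.clm_apply (hasDerivAt_const (0 : ℝ) v)).deriv
    simpa using this
  rw [iteratedFDeriv_two_apply]
  simp only [Matrix.cons_val_zero, Matrix.cons_val_one]
  rw [← h2, ← h1]
  set a := Real.sqrt |lam| with ha
  have ha2 : a ^ 2 = |lam| := Real.sq_sqrt (abs_nonneg _)
  set K : ℝ := |lam| ^ ((Fintype.card ι : ℝ) / 4) *
    ∏ j ∈ Finset.univ.erase i, hermiteFun (α j) (a * x j) with hK
  have hfs : (fun s : ℝ => f (x + s • v)) = fun s => K * hermiteFun (α i) (a * s + a * x i) := by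
    funext s
    rw [hf, scaledHermite, ← Finset.mul_prod_erase Finset.univ _ (Finset.mem_univ i)]
    have : ∏ j ∈ Finset.univ.erase i, hermiteFun (α j) (Real.sqrt |lam| * (x + s • v) j) =
        ∏ j ∈ Finset.univ.erase i, hermiteFun (α j) (a * x j) := by
      refine Finset.prod_congr rfl fun j hj => ?_
      simp [hv, (Finset.ne_of_mem_erase hj), ha]
    rw [this, hK]
    have : Real.sqrt |lam| * (x + s • v) i = a * s + a * x i := by
      simp [hv, ha]; ring
    rw [this]; ring
  have hx : f x = K * hermiteFun (α i) (a * x i) := by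
    have := congrFun hfs 0
    simpa using this
  have hg : ∀ (g : ℝ → ℝ), Differentiable ℝ g → ∀ C : ℝ,
      deriv (fun s => C * g (a * s + a * x i)) = fun s => C * a * deriv g (a * s + a * x i) := by
    intro g hg C
    funext s
    have hl : HasDerivAt (fun s : ℝ => a * s + a * x i) a s := by
      simpa using ((hasDerivAt_id' s).const_mul a).add_const (a * x i)
    have := (((hg (a * s + a * x i)).hasDerivAt.comp s hl).const_mul C).deriv
    simp only [Function.comp_def] at this
    rw [this]; ring
  have hgd : Differentiable ℝ (hermiteFun (α i)) :=
    (contDiff_hermiteFun (m := 1) _).differentiable (by norm_num)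
  have hgd' : Differentiable ℝ (deriv (hermiteFun (α i))) :=
    (ContDiff.deriv' (n := 1) (contDiff_hermiteFun (α i))).differentiable (by norm_num)
  rw [hfs, hg _ hgd, hg _ hgd', hx]
  simp only [deriv_deriv_hermiteFun]
  have h4 : lam ^ 2 = a ^ 4 := by rw [show a ^ 4 = (a ^ 2) ^ 2 by ring, ha2, sq_abs]
  rw [h4, ← ha2]
  simp
  ring

/-- `H(λ) Φ_α^λ = (2|α| + d)|λ| Φ_α^λ`. -/
theorem hermiteOp_scaledHermite {ι : Type} [Fintype ι] (lam : ℝ) (α : ι → ℕ)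
    (x : EuclideanSpace ℝ ι) :
    hermiteOp lam (scaledHermite lam α) x = hermiteEigenvalue lam α * scaledHermite lam α x := by
  classical
  rw [hermiteOp, congrFun (InnerProductSpace.laplacian_eq_iteratedFDeriv_orthonormalBasis
    (scaledHermite lam α) (EuclideanSpace.basisFun ι ℝ)) x]
  simp only [EuclideanSpace.basisFun_apply, secondDeriv_scaledHermite]
  rw [← Finset.sum_mul, EuclideanSpace.norm_sq_eq, hermiteEigenvalue]
  simp only [Finset.sum_sub_distrib, ← Finset.mul_sum, ← Finset.sum_mul, Finset.sum_add_distrib,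
    Real.norm_eq_abs, sq_abs, Finset.sum_const, Finset.card_univ, nsmul_eq_mul]
  ring

theorem integrable_hermiteFun_sq (k : ℕ) : Integrable (fun x => hermiteFun k x ^ 2) := by
  have key : ∀ q : Polynomial ℝ, Integrable (fun x : ℝ => q.eval x * Real.exp (-1 * x ^ 2)) := by
    intro q
    induction q using Polynomial.induction_on' with
    | add p q hp hq =>
      simp only [Polynomial.eval_add, add_mul]
      exact hp.add hq
    | monomial m c =>
      have := (integrable_rpow_mul_exp_neg_mul_sq (b := 1) one_pos (s := (m : ℝ))
        (by have := Nat.cast_nonneg (α := ℝ) m; linarith)).const_mul c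
      simpa [Polynomial.eval_monomial, mul_assoc] using this
  refine (key (((Polynomial.C ((Real.sqrt (Real.sqrt Real.pi * (k.factorial : ℝ)))⁻¹) *
    ((Polynomial.hermite k).map (Int.castRingHom ℝ)).comp
      (Polynomial.C (Real.sqrt 2) * Polynomial.X)) ^ 2))).congr (Filter.Eventually.of_forall ?_)
  intro x
  have he : Real.exp (-1 * x ^ 2) = Real.exp (-(x ^ 2 / 2)) ^ 2 := by
    rw [← Real.exp_nat_mul]; congr 1; push_cast; ring
  simp only [hermiteFun, he, Polynomial.eval_pow, Polynomial.eval_mul, Polynomial.eval_C,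
    Polynomial.eval_comp, Polynomial.eval_X, Polynomial.eval_map, Polynomial.aeval_def,
    algebraMap_int_eq]
  ring

/-- Hermite functions are square integrable. -/
theorem memLp_scaledHermite {ι : Type} [Fintype ι] (lam : ℝ) (hlam : lam ≠ 0) (α : ι → ℕ) :
    MemLp (fun x : EuclideanSpace ℝ ι => (scaledHermite lam α x : ℂ)) 2 volume := by
  have hcont : Continuous (scaledHermite lam α) := (contDiff_scaledHermite (m := 0) lam α).continuous
  refine (memLp_two_iff_integrable_sq_norm
    (Complex.continuous_ofReal.comp hcont).aestronglyMeasurable).2 ?_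
  have ha : Real.sqrt |lam| ≠ 0 := by positivity
  have h1 : Integrable (fun y : ι → ℝ => ∏ i, hermiteFun (α i) (Real.sqrt |lam| * y i) ^ 2) :=
    Integrable.fintype_prod (f := fun i y => hermiteFun (α i) (Real.sqrt |lam| * y) ^ 2)
      fun i => (integrable_hermiteFun_sq (α i)).comp_mul_left' ha
  have h2 := ((EuclideanSpace.volume_preserving_symm_measurableEquiv_toLp ι).integrable_comp_emb
    (MeasurableEquiv.measurableEmbedding _)).2 h1
  refine (h2.const_mul ((|lam| ^ ((Fintype.card ι : ℝ) / 4)) ^ 2)).congr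
    (Filter.Eventually.of_forall fun x => ?_)
  have hn : ‖(scaledHermite lam α x : ℂ)‖ ^ 2 = scaledHermite lam α x ^ 2 := by
    rw [Complex.norm_real, Real.norm_eq_abs, sq_abs]
  refine Eq.trans ?_ hn.symm
  simp [scaledHermite, mul_pow, Finset.prod_pow]

/-- `Φ_α^λ` as an element of `L²(ℝ^ι)`. -/
def hermiteL2 {ι : Type} [Fintype ι] (lam : ℝ) (hlam : lam ≠ 0) (α : ι → ℕ) : L2 ι :=
  (memLp_scaledHermite lam hlam α).toLp _

/-! ### The Poisson-Hermite semigroup -/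

/-- `f = e^{-t √H(λ)} g` in `L²(ℝ^ι)`, by the spectral decomposition of `H(λ)` in its orthonormal
basis of eigenfunctions `Φ_α^λ`:
`f = ∑_α e^{-t √((2|α| + d)|λ|)} (g, Φ_α^λ) Φ_α^λ`, with convergence in `L²`. -/
def IsPoissonHermite {ι : Type} [Fintype ι] (t lam : ℝ) (hlam : lam ≠ 0) (g f : L2 ι) : Prop :=
  HasSum (fun α : ι → ℕ =>
    ((Real.exp (-(t * Real.sqrt (hermiteEigenvalue lam α))) : ℂ) *
      inner ℂ (hermiteL2 lam hlam α) g) • hermiteL2 lam hlam α) f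

/-- The space `e^{-t √H(λ)} (L²(ℝ^ι))`. -/
def poissonHermiteSpace (ι : Type) [Fintype ι] (t lam : ℝ) (hlam : lam ≠ 0) : Set (L2 ι) :=
  {f | ∃ g : L2 ι, IsPoissonHermite t lam hlam g f}

/-! ### The Schrödinger representation and the Weyl transform -/

theorem memLp_schrodinger {n : ℕ} (x u : EuclideanSpace ℝ (Fin n)) (φ : L2 (Fin n)) :
    MemLp (fun ξ : EuclideanSpace ℝ (Fin n) =>
      Complex.exp (Complex.I * ((inner ℝ x ξ + 1 / 2 * inner ℝ x u : ℝ) : ℂ)) * φ (ξ + u))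
      2 volume := by
  have h1 : MemLp (fun ξ => φ (ξ + u)) 2 volume :=
    (Lp.memLp φ).comp_measurePreserving (measurePreserving_add_right volume u)
  have hc : Continuous (fun ξ : EuclideanSpace ℝ (Fin n) =>
      Complex.exp (Complex.I * ((inner ℝ x ξ + 1 / 2 * inner ℝ x u : ℝ) : ℂ))) := by
    fun_prop
  refine MemLp.of_le h1 (hc.aestronglyMeasurable.mul h1.1) (Filter.Eventually.of_forall fun ξ => ?_)
  rw [norm_mul, mul_comm Complex.I, Complex.norm_exp_ofReal_mul_I, one_mul]

/-- The Schrödinger representation with parameter `1` at the point `(x, u, 0)` of the Heisenberg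
group, acting on `L²(ℝⁿ)`: `(π(x,u) φ)(ξ) = e^{i (x·ξ + ½ x·u)} φ(ξ + u)`. -/
def schrodinger {n : ℕ} (x u : EuclideanSpace ℝ (Fin n)) (φ : L2 (Fin n)) : L2 (Fin n) :=
  (memLp_schrodinger x u φ).toLp _

/-- The component `x` of a point `(x, u)` of `ℝ²ⁿ = ℝⁿ × ℝⁿ`. -/
def fstHalf {n : ℕ} (p : EuclideanSpace ℝ (Fin n ⊕ Fin n)) : EuclideanSpace ℝ (Fin n) :=
  WithLp.toLp 2 fun i => p (Sum.inl i)

/-- The component `u` of a point `(x, u)` of `ℝ²ⁿ = ℝⁿ × ℝⁿ`. -/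
def sndHalf {n : ℕ} (p : EuclideanSpace ℝ (Fin n ⊕ Fin n)) : EuclideanSpace ℝ (Fin n) :=
  WithLp.toLp 2 fun i => p (Sum.inr i)

/-- The integrand `(x, u) ↦ F(x, u) π(x, u) φ` of the Weyl transform, with values in `L²(ℝⁿ)`. -/
def weylIntegrand {n : ℕ} (F : L2 (Fin n ⊕ Fin n)) (φ : L2 (Fin n))
    (p : EuclideanSpace ℝ (Fin n ⊕ Fin n)) : L2 (Fin n) :=
  F p • schrodinger (fstHalf p) (sndHalf p) φ

/-- The Weyl transform `W(F) φ = ∫_{ℝ²ⁿ} F(x, u) π(x, u) φ dx du`, a Bochner integral in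
`L²(ℝⁿ)`. -/
def weylTransform {n : ℕ} (F : L2 (Fin n ⊕ Fin n)) (φ : L2 (Fin n)) : L2 (Fin n) :=
  ∫ p, weylIntegrand F φ p

end

noncomputable section

/-! ### Hermite functions on the line -/

/-! The Weyl transform becomes diagonalisable bookkeeping once it is tested on Hermite functions.
The matrix entry `(W(F) Φ_k, Φ_j)` is the integral of `F` against the Fourier-Wigner function
`(π(x,u) Φ_k, Φ_j)` (`inner_weylTransform_hermiteL2`). These functions are mutually orthogonal in
`L²(ℝ²ⁿ)` with squared norm `(2π)ⁿ` (`inner_conjFourierWigner`), and the conjugates of all those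
with `|j| + |k| = N` lie in the eigenspace of `H(1/2)` with eigenvalue `N + n`
(`inner_conjFourierWigner_hermiteL2`). Hence for `F = e^{-√2 t √H(1/2)} g` the `(j,k)` entry is that
of `g` times `e^{-√2 t √(|j|+|k|+n)} = e^{-t √((2|j|+n) + (2|k|+n))}`.

The image is contained in the Poisson-Hermite space because this factor is at most `e^{-t
√(2|j|+n)}`: Cauchy-Schwarz in `k` and Bessel's inequality make the coefficients of `W(F)φ`,
multiplied by `e^{t √(2|j|+n)}`, square summable. Conversely, take `φ = Φ_0` and prescribe only the
entries `(j,0)`; since `√((2|j|+n)+n) ≤ √(2|j|+n) + √n`, the required `g` loses at most the constant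
factor `e^{t√n}`.

The eigenspace and orthogonality statements rest on one algebraic fact: a product of two Hermite
functions, rewritten in variables rotated by 45 degrees, involves only products of the same total
degree (`exists_hermiteFun_rotation`). A partial Fourier transform, under which Hermite functions
are eigenfunctions, then gives `fourierWigner_eq`. Absolute convergence follows from `F ∈ L¹`: the
`L¹` norms of Hermite functions grow polynomially while the coefficients of `F` decay like
`e^{-c√|α|}`. -/

theorem aeval_hermite_succ (k : ℕ) (y : ℝ) :
    Polynomial.aeval y (Polynomial.hermite (k + 1)) =
      y * Polynomial.aeval y (Polynomial.hermite k) -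
        k * Polynomial.aeval y (Polynomial.hermite (k - 1)) := by
  rw [Polynomial.hermite_succ]
  cases k with
  | zero => simp
  | succ k => rw [derivative_hermite_succ]; simp

theorem aeval_derivative_hermite (k : ℕ) (y : ℝ) :
    Polynomial.aeval y (Polynomial.derivative (Polynomial.hermite k)) =
      k * Polynomial.aeval y (Polynomial.hermite (k - 1)) := by
  cases k with
  | zero => simp
  | succ k => rw [derivative_hermite_succ]; simp

/-- The normalising constant of `hermiteFun`. -/
def hermiteConst (k : ℕ) : ℝ := (Real.sqrt (Real.sqrt Real.pi * (k.factorial : ℝ)))⁻¹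

theorem hermiteFun_eq (k : ℕ) (x : ℝ) :
    hermiteFun k x = hermiteConst k * Polynomial.aeval (Real.sqrt 2 * x) (Polynomial.hermite k) *
      Real.exp (-(x ^ 2 / 2)) := rfl

theorem hermiteConst_succ (k : ℕ) :
    hermiteConst k = Real.sqrt (k + 1) * hermiteConst (k + 1) := by
  unfold hermiteConst
  have h : (0 : ℝ) < k + 1 := by positivity
  rw [Nat.factorial_succ]
  push_cast
  rw [show Real.sqrt Real.pi * (((k : ℝ) + 1) * k.factorial) =
    (k + 1) * (Real.sqrt Real.pi * k.factorial) by ring, Real.sqrt_mul h.le, mul_inv,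
    mul_inv_cancel_left₀ (Real.sqrt_pos.2 h).ne']

/-- At `k = 0` the truncated index `k - 1` is harmless because its coefficient vanishes. The
lowering terms below rely on the same convention. -/
theorem hermiteConst_mul_natCast (k : ℕ) :
    hermiteConst k * k = Real.sqrt k * hermiteConst (k - 1) := by
  cases k with
  | zero => simp
  | succ k =>
    have h : (0 : ℝ) ≤ k + 1 := by positivity
    simp only [Nat.add_sub_cancel, Nat.cast_add, Nat.cast_one]
    rw [hermiteConst_succ k, ← mul_assoc, Real.mul_self_sqrt h, mul_comm]

/-- The three-term recurrence of the Hermite functions. -/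
theorem sqrt_two_mul_hermiteFun (k : ℕ) (x : ℝ) :
    Real.sqrt 2 * x * hermiteFun k x =
      Real.sqrt (k + 1) * hermiteFun (k + 1) x + Real.sqrt k * hermiteFun (k - 1) x := by
  have h1 := hermiteConst_succ k
  have h2 := hermiteConst_mul_natCast k
  have h3 := aeval_hermite_succ k (Real.sqrt 2 * x)
  simp only [hermiteFun_eq]
  linear_combination (-Real.exp (-(x ^ 2 / 2)) *
      Polynomial.aeval (Real.sqrt 2 * x) (Polynomial.hermite (k - 1))) * h2 * (-1) +
    (Real.exp (-(x ^ 2 / 2)) *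
      Polynomial.aeval (Real.sqrt 2 * x) (Polynomial.hermite (k + 1))) * h1 -
    hermiteConst k * Real.exp (-(x ^ 2 / 2)) * h3

/-- Expressing the derivative through the neighbours `k ± 1` keeps integration by parts and the
ladder operators inside the Hermite family. -/
theorem hasDerivAt_hermiteFun (k : ℕ) (x : ℝ) :
    HasDerivAt (hermiteFun k) ((Real.sqrt 2)⁻¹ *
      (Real.sqrt k * hermiteFun (k - 1) x - Real.sqrt (k + 1) * hermiteFun (k + 1) x)) x := by
  refine (hasDerivAt_aeval_mul_exp (Polynomial.hermite k) (hermiteConst k) x).congr_deriv ?_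
  rw [aeval_derivative_hermite]
  have h2 := hermiteConst_mul_natCast k
  have h := sqrt_two_mul_hermiteFun k x
  have hs : Real.sqrt 2 * Real.sqrt 2 = 2 := Real.mul_self_sqrt (by norm_num)
  have h0 : Real.sqrt 2 ≠ 0 := by positivity
  rw [eq_inv_mul_iff_mul_eq₀ h0]
  simp only [hermiteFun_eq] at h ⊢
  linear_combination (2 * Real.exp (-(x ^ 2 / 2)) *
      Polynomial.aeval (Real.sqrt 2 * x) (Polynomial.hermite (k - 1))) * h2 - h +
    (Real.exp (-(x ^ 2 / 2)) * hermiteConst k * k *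
      Polynomial.aeval (Real.sqrt 2 * x) (Polynomial.hermite (k - 1))) * hs

/-- The creation operator `x - d/dx`. -/
theorem creation_hermiteFun (k : ℕ) (x : ℝ) :
    x * hermiteFun k x - (Real.sqrt 2)⁻¹ *
      (Real.sqrt k * hermiteFun (k - 1) x - Real.sqrt (k + 1) * hermiteFun (k + 1) x) =
      Real.sqrt 2 * Real.sqrt (k + 1) * hermiteFun (k + 1) x := by
  have h := sqrt_two_mul_hermiteFun k x
  have h2 : Real.sqrt 2 * Real.sqrt 2 = 2 := Real.mul_self_sqrt (by norm_num)
  have h0 : Real.sqrt 2 ≠ 0 := by positivity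
  refine mul_left_cancel₀ h0 ?_
  rw [mul_sub, mul_inv_cancel_left₀ h0]
  linear_combination h - Real.sqrt (k + 1) * hermiteFun (k + 1) x * h2

theorem hermiteFun_zero (x : ℝ) :
    hermiteFun 0 x = hermiteConst 0 * Real.exp (-(x ^ 2 / 2)) := by
  simp [hermiteFun, hermiteConst]

theorem hermiteConst_zero_sq : hermiteConst 0 ^ 2 = (Real.sqrt Real.pi)⁻¹ := by
  simp only [hermiteConst, Nat.factorial_zero, Nat.cast_one, mul_one, inv_pow]
  rw [Real.sq_sqrt (Real.sqrt_nonneg _)]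

theorem hermiteConst_pos (k : ℕ) : 0 < hermiteConst k := by
  unfold hermiteConst; positivity

/-! ### Orthonormality, `L¹` bounds and Fourier transforms on the line -/

theorem continuous_hermiteFun (k : ℕ) : Continuous (hermiteFun k) :=
  (contDiff_hermiteFun (m := 0) k).continuous

theorem memLp_hermiteFun (k : ℕ) : MemLp (hermiteFun k) 2 volume :=
  (memLp_two_iff_integrable_sq (continuous_hermiteFun k).aestronglyMeasurable).2
    (integrable_hermiteFun_sq k)

theorem integrable_hermiteFun_mul (j k : ℕ) :
    Integrable (fun x => hermiteFun j x * hermiteFun k x) :=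
  (memLp_hermiteFun j).integrable_mul (memLp_hermiteFun k)

/-- Creation `x - d/dx` and annihilation `x + d/dx` are adjoint: `(h_j h_k)'` is `h_j (x h_k + h_k')
- (x h_j - h_j') h_k`, and it integrates to zero. -/
theorem sqrt_mul_integral_hermiteFun (j k : ℕ) :
    Real.sqrt (j + 1) * ∫ x, hermiteFun (j + 1) x * hermiteFun k x =
      Real.sqrt k * ∫ x, hermiteFun j x * hermiteFun (k - 1) x := by
  have h2 : Real.sqrt 2 ≠ 0 := by positivity
  have hd : ∀ x, HasDerivAt (fun x => hermiteFun j x * hermiteFun k x)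
      (Real.sqrt 2 * (Real.sqrt k * (hermiteFun j x * hermiteFun (k - 1) x) -
        Real.sqrt (j + 1) * (hermiteFun (j + 1) x * hermiteFun k x))) x := fun x => by
    refine ((hasDerivAt_hermiteFun j x).mul (hasDerivAt_hermiteFun k x)).congr_deriv ?_
    have hs : (Real.sqrt 2)⁻¹ * 2 = Real.sqrt 2 := by
      rw [inv_mul_eq_iff_eq_mul₀ h2, Real.mul_self_sqrt (by norm_num)]
    have h3 := sqrt_two_mul_hermiteFun j x
    have h4 := sqrt_two_mul_hermiteFun k x
    linear_combination ((Real.sqrt 2)⁻¹ * hermiteFun j x) * h4 -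
      ((Real.sqrt 2)⁻¹ * hermiteFun k x) * h3 +
      (Real.sqrt k * (hermiteFun j x * hermiteFun (k - 1) x) -
        Real.sqrt (j + 1) * (hermiteFun (j + 1) x * hermiteFun k x)) * hs
  have i1 := (integrable_hermiteFun_mul j (k - 1)).const_mul (Real.sqrt k)
  have i2 := (integrable_hermiteFun_mul (j + 1) k).const_mul (Real.sqrt (j + 1))
  have h0 := integral_eq_zero_of_hasDerivAt_of_integrable hd ((i1.sub i2).const_mul _)
    (integrable_hermiteFun_mul j k)
  rw [integral_const_mul, integral_sub i1 i2, integral_const_mul, integral_const_mul] at h0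
  have := (mul_eq_zero.1 h0).resolve_left h2
  linarith

/-- The Hermite functions are orthonormal. -/
theorem integral_hermiteFun_mul (j k : ℕ) :
    ∫ x, hermiteFun j x * hermiteFun k x = if j = k then 1 else 0 := by
  have hz : ∀ j, ∫ x, hermiteFun (j + 1) x * hermiteFun 0 x = 0 := fun j => by
    have h := sqrt_mul_integral_hermiteFun j 0
    simp only [Nat.cast_zero, Real.sqrt_zero, zero_mul] at h
    exact (mul_eq_zero.1 h).resolve_left (by positivity)
  -- The identity lowers both indices together, until one of them is zero; there `hz` or the
  -- Gaussian integral decides.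
  induction j generalizing k with
  | zero =>
    cases k with
    | zero =>
      have : ∀ x, hermiteFun 0 x * hermiteFun 0 x =
          hermiteConst 0 ^ 2 * Real.exp (-1 * x ^ 2) := fun x => by
        rw [hermiteFun_zero, show -1 * x ^ 2 = -(x ^ 2 / 2) + -(x ^ 2 / 2) by ring, Real.exp_add]
        ring
      simp only [this]
      rw [integral_const_mul, integral_gaussian, hermiteConst_zero_sq, div_one, if_pos trivial]
      exact inv_mul_cancel₀ (by positivity)
    | succ k => simpa [mul_comm] using hz k
  | succ j ih =>
    cases k with
    | zero => simpa using hz j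
    | succ k =>
      have h := sqrt_mul_integral_hermiteFun j (k + 1)
      simp only [Nat.add_sub_cancel, ih] at h
      by_cases hjk : j = k
      · subst hjk
        simp only [if_true, Nat.cast_add, Nat.cast_one] at h ⊢
        exact mul_left_cancel₀ (by positivity) h
      · simp only [hjk, if_false, mul_zero, add_left_inj] at h ⊢
        exact (mul_eq_zero.1 h).resolve_left (by positivity)

/-- The AM-GM inequality `2|f| ≤ (1+x²)⁻¹ + (1+x²) f²` trades `L¹` for a weighted `L²` bound, and
the recurrence turns `x f` into neighbouring Hermite functions, whose `L²` norms are known. -/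
theorem abs_hermiteFun_le (k : ℕ) (x : ℝ) :
    |hermiteFun k x| ≤ (1 / 2) * ((1 + x ^ 2)⁻¹ + (hermiteFun k x * hermiteFun k x +
      ((k + 1) * (hermiteFun (k + 1) x * hermiteFun (k + 1) x) +
        k * (hermiteFun (k - 1) x * hermiteFun (k - 1) x)))) := by
  have h := sqrt_two_mul_hermiteFun k x
  set p := Real.sqrt (k + 1) * hermiteFun (k + 1) x with hp
  set q := Real.sqrt k * hermiteFun (k - 1) x with hq
  have hp2 : p ^ 2 = (k + 1) * (hermiteFun (k + 1) x * hermiteFun (k + 1) x) := by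
    rw [hp, mul_pow, Real.sq_sqrt (by positivity)]; ring
  have hq2 : q ^ 2 = k * (hermiteFun (k - 1) x * hermiteFun (k - 1) x) := by
    rw [hq, mul_pow, Real.sq_sqrt (by positivity)]; ring
  rw [← hp2, ← hq2]
  set f := hermiteFun k x
  have h2 : 2 * (x * f) ^ 2 ≤ 2 * (p ^ 2 + q ^ 2) := by
    have : 2 * (x * f) ^ 2 = (p + q) ^ 2 := by
      rw [← h, mul_assoc, mul_pow (Real.sqrt 2), Real.sq_sqrt (by norm_num)]
    rw [this]; nlinarith [sq_nonneg (p - q)]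
  have hx : (0 : ℝ) < 1 + x ^ 2 := by positivity
  have h3 : 2 * |f| ≤ (1 + x ^ 2)⁻¹ + (1 + x ^ 2) * f ^ 2 := by
    have : (1 + x ^ 2)⁻¹ + (1 + x ^ 2) * f ^ 2 - 2 * |f| =
        (1 + x ^ 2)⁻¹ * (1 - (1 + x ^ 2) * |f|) ^ 2 := by
      field_simp
      rw [show f ^ 2 = |f| ^ 2 from (sq_abs f).symm]; ring
    have h4 : 0 ≤ (1 + x ^ 2)⁻¹ * (1 - (1 + x ^ 2) * |f|) ^ 2 := by positivity
    linarith
  nlinarith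

theorem integrable_abs_hermiteFun_bound (k : ℕ) :
    Integrable (fun x : ℝ => (1 / 2) * ((1 + x ^ 2)⁻¹ + (hermiteFun k x * hermiteFun k x +
      ((k + 1) * (hermiteFun (k + 1) x * hermiteFun (k + 1) x) +
        k * (hermiteFun (k - 1) x * hermiteFun (k - 1) x))))) :=
  (integrable_inv_one_add_sq.add ((integrable_hermiteFun_mul k k).add
    (((integrable_hermiteFun_mul _ _).const_mul _).add
      ((integrable_hermiteFun_mul _ _).const_mul _)))).const_mul _

theorem integrable_hermiteFun (k : ℕ) : Integrable (hermiteFun k) :=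
  (integrable_abs_hermiteFun_bound k).mono' (continuous_hermiteFun k).aestronglyMeasurable
    (Filter.Eventually.of_forall fun x => abs_hermiteFun_le k x)

/-- The `L¹` norms of the Hermite functions grow at most linearly. -/
theorem integral_abs_hermiteFun_le (k : ℕ) : ∫ x, |hermiteFun k x| ≤ 3 * (k + 1) := by
  refine (integral_mono (integrable_hermiteFun k).abs (integrable_abs_hermiteFun_bound k)
    (abs_hermiteFun_le k)).trans ?_
  have i1 := integrable_hermiteFun_mul k k
  have i2 := (integrable_hermiteFun_mul (k + 1) (k + 1)).const_mul ((k : ℝ) + 1)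
  have i3 := (integrable_hermiteFun_mul (k - 1) (k - 1)).const_mul (k : ℝ)
  have i23 : Integrable (fun x => ((k : ℝ) + 1) * (hermiteFun (k + 1) x * hermiteFun (k + 1) x) +
    k * (hermiteFun (k - 1) x * hermiteFun (k - 1) x)) := i2.add i3
  have i123 : Integrable (fun x => hermiteFun k x * hermiteFun k x +
    (((k : ℝ) + 1) * (hermiteFun (k + 1) x * hermiteFun (k + 1) x) +
    k * (hermiteFun (k - 1) x * hermiteFun (k - 1) x))) := i1.add i23
  rw [integral_const_mul, integral_add integrable_inv_one_add_sq i123, integral_add i1 i23, integral_add i2 i3, integral_const_mul, integral_const_mul]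
  simp only [integral_hermiteFun_mul, if_true, integral_univ_inv_one_add_sq]
  -- The integrated bound is `½(π + 2k + 2)`, which is below `k + 3 ≤ 3(k + 1)`.
  have := Real.pi_lt_four
  have : (0 : ℝ) ≤ k := by positivity
  linarith

theorem integrable_exp_mul_hermiteFun (a : ℕ) (y : ℝ) :
    Integrable (fun s : ℝ => Complex.exp (Complex.I * ((y * s : ℝ) : ℂ)) *
      (hermiteFun a s : ℂ)) := by
  refine ((integrable_hermiteFun a).ofReal (𝕜 := ℂ)).mono
    (by have := continuous_hermiteFun a; exact (by fun_prop : Continuous _).aestronglyMeasurable)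
    (Filter.Eventually.of_forall fun s => ?_)
  rw [norm_mul, mul_comm Complex.I, Complex.norm_exp_ofReal_mul_I, one_mul]
  exact le_rfl

/-- The Hermite functions are eigenfunctions of the Fourier transform. -/
theorem integral_exp_mul_hermiteFun (a : ℕ) (y : ℝ) :
    ∫ s : ℝ, Complex.exp (Complex.I * ((y * s : ℝ) : ℂ)) * (hermiteFun a s : ℂ) =
      (Real.sqrt (2 * Real.pi) : ℂ) * Complex.I ^ a * (hermiteFun a y : ℂ) := by
  have hint := fun a => integrable_exp_mul_hermiteFun a y
  have h0 : Real.sqrt 2 ≠ 0 := by positivity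
  -- The integral of the derivative of `√2 e^{iys} h_a(s)` vanishes, which links the transforms of
  -- `h_{a+1}`, `h_a` and `h_{a-1}`.
  have hrec : ∀ a : ℕ, (Real.sqrt (a + 1) : ℂ) *
      ∫ s : ℝ, Complex.exp (Complex.I * ((y * s : ℝ) : ℂ)) * (hermiteFun (a + 1) s : ℂ) =
      Complex.I * (Real.sqrt 2 : ℂ) * y *
        (∫ s : ℝ, Complex.exp (Complex.I * ((y * s : ℝ) : ℂ)) * (hermiteFun a s : ℂ)) +
      (Real.sqrt a : ℂ) *
        ∫ s : ℝ, Complex.exp (Complex.I * ((y * s : ℝ) : ℂ)) * (hermiteFun (a - 1) s : ℂ) := by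
    intro a
    have hd : ∀ s : ℝ, HasDerivAt (fun s : ℝ => (Real.sqrt 2 : ℂ) *
        (Complex.exp (Complex.I * ((y * s : ℝ) : ℂ)) * (hermiteFun a s : ℂ)))
        (Complex.I * (Real.sqrt 2 : ℂ) * y *
          (Complex.exp (Complex.I * ((y * s : ℝ) : ℂ)) * (hermiteFun a s : ℂ)) +
        (Real.sqrt a : ℂ) *
          (Complex.exp (Complex.I * ((y * s : ℝ) : ℂ)) * (hermiteFun (a - 1) s : ℂ)) -
        (Real.sqrt (a + 1) : ℂ) *
          (Complex.exp (Complex.I * ((y * s : ℝ) : ℂ)) * (hermiteFun (a + 1) s : ℂ))) s := by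
      intro s
      have h1 : HasDerivAt (fun s : ℝ => Complex.exp (Complex.I * ((y * s : ℝ) : ℂ)))
          (Complex.exp (Complex.I * ((y * s : ℝ) : ℂ)) * (Complex.I * ((y * 1 : ℝ) : ℂ))) s :=
        ((((hasDerivAt_id' s).const_mul y).ofReal_comp).const_mul Complex.I).cexp
      refine ((h1.mul (hasDerivAt_hermiteFun a s).ofReal_comp).const_mul _).congr_deriv ?_
      have hc : (Real.sqrt 2 : ℂ) * (Real.sqrt 2 : ℂ)⁻¹ = 1 :=
        mul_inv_cancel₀ (by exact_mod_cast h0)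
      push_cast
      linear_combination (Complex.exp (Complex.I * (y * s)) *
        ((Real.sqrt a : ℂ) * hermiteFun (a - 1) s -
          (Real.sqrt (a + 1) : ℂ) * hermiteFun (a + 1) s)) * hc
    have i1 := (hint a).const_mul (Complex.I * (Real.sqrt 2 : ℂ) * y)
    have i2 := (hint (a - 1)).const_mul (Real.sqrt a : ℂ)
    have i3 := (hint (a + 1)).const_mul (Real.sqrt (a + 1) : ℂ)
    have h := integral_eq_zero_of_hasDerivAt_of_integrable hd ((i1.add i2).sub i3)
      ((hint a).const_mul _)
    have i12 : Integrable (fun s : ℝ => Complex.I * (Real.sqrt 2 : ℂ) * y *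
          (Complex.exp (Complex.I * ((y * s : ℝ) : ℂ)) * (hermiteFun a s : ℂ)) +
        (Real.sqrt a : ℂ) *
          (Complex.exp (Complex.I * ((y * s : ℝ) : ℂ)) * (hermiteFun (a - 1) s : ℂ))) := i1.add i2
    rw [integral_sub i12 i3, integral_add i1 i2, integral_const_mul, integral_const_mul,
      integral_const_mul] at h
    exact (sub_eq_zero.1 h).symm
  induction a using Nat.strong_induction_on with
  | _ a ih =>
    cases a with
    | zero =>
      have hf := fourierIntegral_gaussian (b := 1 / 2) (by norm_num) (y : ℂ)
      have : ∀ s : ℝ, Complex.exp (Complex.I * ((y * s : ℝ) : ℂ)) * (hermiteFun 0 s : ℂ) =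
          (hermiteConst 0 : ℂ) * (Complex.exp (Complex.I * y * s) *
            Complex.exp (-(1 / 2) * (s : ℂ) ^ 2)) := fun s => by
        rw [hermiteFun_zero]; push_cast
        rw [show -((s : ℂ) ^ 2 / 2) = -(1 / 2) * (s : ℂ) ^ 2 by ring,
          ← mul_assoc Complex.I]
        ring
      simp only [this]
      rw [integral_const_mul, hf, hermiteFun_zero]
      have h2 : ((Real.pi : ℂ) / (1 / 2)) ^ (1 / 2 : ℂ) = (Real.sqrt (2 * Real.pi) : ℂ) := by
        rw [Real.sqrt_eq_rpow, Complex.ofReal_cpow (by positivity)]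
        congr 1 <;> push_cast <;> ring
      rw [h2]
      push_cast
      rw [show -(y : ℂ) ^ 2 / (4 * (1 / 2)) = -((y : ℂ) ^ 2 / 2) by ring]
      ring
    | succ a =>
      have h := hrec a
      rw [ih a (by omega), ih (a - 1) (by omega)] at h
      have hs : (Real.sqrt (a + 1) : ℂ) ≠ 0 := by
        exact_mod_cast (by positivity : Real.sqrt ((a : ℝ) + 1) ≠ 0)
      refine mul_left_cancel₀ hs (h.trans ?_)
      have h3 : (Real.sqrt 2 : ℂ) * y * hermiteFun a y =
          (Real.sqrt (a + 1) : ℂ) * hermiteFun (a + 1) y +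
            (Real.sqrt a : ℂ) * hermiteFun (a - 1) y := by
        exact_mod_cast congrArg (fun r : ℝ => (r : ℂ)) (sqrt_two_mul_hermiteFun a y)
      -- Replacing `I^(a-1)` by `-I^(a+1)` makes the recursion for the transforms match the
      -- three-term recurrence; at `a = 0` both sides are zero.
      have h4 : (Real.sqrt a : ℂ) * Complex.I ^ (a - 1) = -(Real.sqrt a : ℂ) * Complex.I ^ (a + 1) := by
        cases a with
        | zero => simp
        | succ a =>
          rw [Nat.add_sub_cancel, pow_succ, pow_succ]
          linear_combination ((Real.sqrt ((a + 1 : ℕ) : ℝ) : ℂ) * Complex.I ^ a) * Complex.I_mul_I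
      rw [pow_succ] at h4 ⊢
      linear_combination ((Real.sqrt (2 * Real.pi) : ℂ) * Complex.I ^ a * Complex.I) * h3 +
        ((Real.sqrt (2 * Real.pi) : ℂ) * hermiteFun (a - 1) y) * h4

/-! ### Rotations by 45 degrees -/

/-- In the rotated variables `v - d/dv` is `1/√2` times the creation operator in `(v+s)/√2` plus `ε`
times the one in `ε(v-s)/√2`, so it raises the total degree by exactly one. The sign `ε = ±1` lets
one computation serve both original variables. -/
theorem creation_rotated_sum (N : ℕ) (c : ℕ × ℕ → ℝ) (ε : ℝ) (hε : ε * ε = 1) (s v : ℝ)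
    (g : ℝ → ℝ) (g' : ℝ)
    (hg : ∀ v, g v = ∑ p ∈ Finset.HasAntidiagonal.antidiagonal N, c p *
      (hermiteFun p.1 ((v + s) / Real.sqrt 2) * hermiteFun p.2 (ε * ((v - s) / Real.sqrt 2))))
    (hd : HasDerivAt g g' v) :
    v * g v - g' = ∑ p ∈ Finset.HasAntidiagonal.antidiagonal (N + 1),
      (Real.sqrt p.1 * c (p.1 - 1, p.2) + ε * Real.sqrt p.2 * c (p.1, p.2 - 1)) *
      (hermiteFun p.1 ((v + s) / Real.sqrt 2) * hermiteFun p.2 (ε * ((v - s) / Real.sqrt 2))) := by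
  have h0 : Real.sqrt 2 ≠ 0 := by positivity
  have hs : Real.sqrt 2 * Real.sqrt 2 = 2 := Real.mul_self_sqrt (by norm_num)
  set D : ℕ → ℝ → ℝ := fun k x => (Real.sqrt 2)⁻¹ *
      (Real.sqrt k * hermiteFun (k - 1) x - Real.sqrt (k + 1) * hermiteFun (k + 1) x) with hD
  have hterm : ∀ p : ℕ × ℕ, HasDerivAt (fun v => c p *
      (hermiteFun p.1 ((v + s) / Real.sqrt 2) * hermiteFun p.2 (ε * ((v - s) / Real.sqrt 2))))
      (c p * ((D p.1 ((v + s) / Real.sqrt 2) * (1 / Real.sqrt 2)) *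
          hermiteFun p.2 (ε * ((v - s) / Real.sqrt 2)) +
        hermiteFun p.1 ((v + s) / Real.sqrt 2) *
          (D p.2 (ε * ((v - s) / Real.sqrt 2)) * (ε * (1 / Real.sqrt 2))))) v := fun p => by
    have h1 := (hasDerivAt_hermiteFun p.1 ((v + s) / Real.sqrt 2)).comp v
      (((hasDerivAt_id' v).add_const s).div_const (Real.sqrt 2))
    have h2 := (hasDerivAt_hermiteFun p.2 (ε * ((v - s) / Real.sqrt 2))).comp v
      ((((hasDerivAt_id' v).sub_const s).div_const (Real.sqrt 2)).const_mul ε)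
    exact (h1.mul h2).const_mul (c p)
  have hgd : HasDerivAt g _ v :=
    (HasDerivAt.fun_sum fun p (_ : p ∈ Finset.HasAntidiagonal.antidiagonal N) => hterm p).congr_of_eventuallyEq
      (Filter.Eventually.of_forall hg)
  rw [hd.unique hgd, hg, Finset.mul_sum, ← Finset.sum_sub_distrib]
  simp only [add_mul]
  -- The boundary terms with `p.1 = 0` or `p.2 = 0` carry a factor `√0`, so the truncated indices
  -- never contribute.
  rw [Finset.sum_add_distrib, Finset.Nat.sum_antidiagonal_succ (n := N)]
  simp only [Nat.cast_zero, Real.sqrt_zero, zero_mul, zero_add, Nat.add_sub_cancel]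
  rw [Finset.Nat.sum_antidiagonal_succ' (n := N)]
  simp only [Nat.cast_zero, Real.sqrt_zero, mul_zero, zero_mul, zero_add,
    Nat.add_sub_cancel, ← Finset.sum_add_distrib]
  refine Finset.sum_congr rfl fun p _ => ?_
  have c1 := creation_hermiteFun p.1 ((v + s) / Real.sqrt 2)
  have c2 := creation_hermiteFun p.2 (ε * ((v - s) / Real.sqrt 2))
  have hv : v = ((v + s) / Real.sqrt 2 + ε * (ε * ((v - s) / Real.sqrt 2))) / Real.sqrt 2 := by
    rw [← mul_assoc, hε]; field_simp; linear_combination v * hs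
  set x := (v + s) / Real.sqrt 2
  set y := ε * ((v - s) / Real.sqrt 2)
  have hi : Real.sqrt 2 * (Real.sqrt 2)⁻¹ = 1 := mul_inv_cancel₀ h0
  rw [hv]
  simp only [hD]
  push_cast
  simp only [div_eq_mul_inv, one_mul]
  linear_combination (c p * (Real.sqrt 2)⁻¹ * hermiteFun p.2 y) * c1 +
    (ε * c p * (Real.sqrt 2)⁻¹ * hermiteFun p.1 x) * c2 +
    (c p * (Real.sqrt (p.1 + 1) * hermiteFun (p.1 + 1) x * hermiteFun p.2 y +
      ε * Real.sqrt (p.2 + 1) * hermiteFun p.1 x * hermiteFun (p.2 + 1) y)) * hi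

/-- A product of Hermite functions in rotated variables is a combination of products of
Hermite functions of the same total degree. -/
theorem exists_hermiteFun_rotation (j k : ℕ) : ∃ c : ℕ × ℕ → ℝ, ∀ y w : ℝ,
    hermiteFun k y * hermiteFun j w = ∑ p ∈ Finset.HasAntidiagonal.antidiagonal (j + k), c p *
      (hermiteFun p.1 ((y + w) / Real.sqrt 2) * hermiteFun p.2 ((y - w) / Real.sqrt 2)) := by
  have hs : Real.sqrt 2 ^ 2 = 2 := Real.sq_sqrt (by norm_num)
  -- The base case is rotation invariance of the Gaussian. Creation in `y` raises `k` with `ε = 1`;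
  -- creation in `w` raises `j` with `ε = -1`, because `y - w = -(w - y)`.
  induction j with
  | zero =>
    induction k with
    | zero =>
      refine ⟨fun _ => 1, fun y w => ?_⟩
      simp only [add_zero, Finset.Nat.antidiagonal_zero, Finset.sum_singleton, one_mul,
        hermiteFun_zero]
      have : ∀ a b : ℝ, hermiteConst 0 * Real.exp a * (hermiteConst 0 * Real.exp b) =
          hermiteConst 0 ^ 2 * Real.exp (a + b) := fun a b => by rw [Real.exp_add]; ring
      rw [this, this, div_pow, div_pow, hs]
      congr 2; ring
    | succ k ih =>
      obtain ⟨c, hc⟩ := ih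
      refine ⟨fun p => (Real.sqrt 2 * Real.sqrt (k + 1))⁻¹ *
        (Real.sqrt p.1 * c (p.1 - 1, p.2) + Real.sqrt p.2 * c (p.1, p.2 - 1)), fun y w => ?_⟩
      have h := creation_rotated_sum (0 + k) c 1 (by norm_num) w y
        (fun y => hermiteFun k y * hermiteFun 0 w) _ (fun v => by simpa using hc v w)
        ((hasDerivAt_hermiteFun k y).mul_const _)
      simp only [mul_assoc ((Real.sqrt 2 * Real.sqrt ((k : ℝ) + 1))⁻¹)]
      rw [← Finset.mul_sum, eq_inv_mul_iff_mul_eq₀ (by positivity)]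
      simp only [one_mul] at h
      rw [← add_assoc, ← h]
      linear_combination (-hermiteFun 0 w) * creation_hermiteFun k y
  | succ j ih =>
    obtain ⟨c, hc⟩ := ih
    refine ⟨fun p => (Real.sqrt 2 * Real.sqrt (j + 1))⁻¹ *
      (Real.sqrt p.1 * c (p.1 - 1, p.2) + -1 * Real.sqrt p.2 * c (p.1, p.2 - 1)), fun y w => ?_⟩
    have e1 : ∀ w : ℝ, (y + w) / Real.sqrt 2 = (w + y) / Real.sqrt 2 := fun w => by ring
    have e2 : ∀ w : ℝ, (y - w) / Real.sqrt 2 = -1 * ((w - y) / Real.sqrt 2) := fun w => by ring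
    have h := creation_rotated_sum (j + k) c (-1) (by norm_num) y w
      (fun w => hermiteFun k y * hermiteFun j w) _ (fun v => by rw [hc, e1, e2])
      ((hasDerivAt_hermiteFun j w).const_mul _)
    simp only [mul_assoc ((Real.sqrt 2 * Real.sqrt ((j : ℝ) + 1))⁻¹)]
    rw [← Finset.mul_sum, eq_inv_mul_iff_mul_eq₀ (by positivity), add_right_comm, e1, e2, ← h]
    linear_combination (-hermiteFun k y) * creation_hermiteFun j w

/-! ### The Hermite basis of `L²(ℝ^ι)` -/

variable {ι : Type} [Fintype ι]

theorem integral_euclideanSpace_prod {𝕜 : Type*} [RCLike 𝕜] (f : ι → ℝ → 𝕜) :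
    ∫ x : EuclideanSpace ℝ ι, ∏ i, f i (x i) = ∏ i, ∫ s, f i s := by
  rw [← integral_fintype_prod_volume_eq_prod]
  exact (EuclideanSpace.volume_preserving_symm_measurableEquiv_toLp ι).integral_comp'
    (fun y : ι → ℝ => ∏ i, f i (y i))

theorem integrable_euclideanSpace_prod {𝕜 : Type*} [RCLike 𝕜] {f : ι → ℝ → 𝕜}
    (hf : ∀ i, Integrable (f i)) :
    Integrable (fun x : EuclideanSpace ℝ ι => ∏ i, f i (x i)) :=
  ((EuclideanSpace.volume_preserving_symm_measurableEquiv_toLp ι).integrable_comp_emb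
    (MeasurableEquiv.measurableEmbedding _)).2 (Integrable.fintype_prod hf)

theorem coeFn_hermiteL2 (lam : ℝ) (hlam : lam ≠ 0) (α : ι → ℕ) :
    hermiteL2 lam hlam α =ᵐ[volume] fun x => (scaledHermite lam α x : ℂ) :=
  MemLp.coeFn_toLp _

theorem inner_hermiteL2_left (lam : ℝ) (hlam : lam ≠ 0) (α : ι → ℕ) (f : L2 ι) :
    inner ℂ (hermiteL2 lam hlam α) f = ∫ x, (scaledHermite lam α x : ℂ) * f x := by
  rw [L2.inner_def]
  refine integral_congr_ae ?_
  filter_upwards [coeFn_hermiteL2 lam hlam α] with x hx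
  rw [hx, RCLike.inner_apply, Complex.conj_ofReal, mul_comm]

theorem continuous_scaledHermite (lam : ℝ) (α : ι → ℕ) : Continuous (scaledHermite lam α) :=
  (contDiff_scaledHermite (m := 0) lam α).continuous

theorem integral_scaledHermite_mul (lam : ℝ) (hlam : lam ≠ 0) (α β : ι → ℕ) :
    ∫ x, scaledHermite lam α x * scaledHermite lam β x = if α = β then 1 else 0 := by
  have ha : 0 < Real.sqrt |lam| := by positivity
  have h1 : ∀ x : EuclideanSpace ℝ ι, scaledHermite lam α x * scaledHermite lam β x =
      (|lam| ^ ((Fintype.card ι : ℝ) / 4)) ^ 2 * ∏ i, (hermiteFun (α i) (Real.sqrt |lam| * x i) *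
        hermiteFun (β i) (Real.sqrt |lam| * x i)) := fun x => by
    rw [scaledHermite, scaledHermite, Finset.prod_mul_distrib]; ring
  simp only [h1]
  rw [integral_const_mul, integral_euclideanSpace_prod (fun i s =>
    hermiteFun (α i) (Real.sqrt |lam| * s) * hermiteFun (β i) (Real.sqrt |lam| * s))]
  have h2 : ∀ i, ∫ s, hermiteFun (α i) (Real.sqrt |lam| * s) *
      hermiteFun (β i) (Real.sqrt |lam| * s) =
      (Real.sqrt |lam|)⁻¹ * if α i = β i then 1 else 0 := fun i => by
    rw [Measure.integral_comp_mul_left (fun s => hermiteFun (α i) s * hermiteFun (β i) s),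
      integral_hermiteFun_mul, abs_of_pos (inv_pos.2 ha), smul_eq_mul]
  simp only [h2]
  rw [Finset.prod_mul_distrib, Finset.prod_const, Finset.card_univ]
  -- The two factors `|λ|^{d/4}` cancel the Jacobian `|λ|^{-d/2}` of the dilation.
  have h3 : (|lam| ^ ((Fintype.card ι : ℝ) / 4)) ^ 2 * (Real.sqrt |lam|)⁻¹ ^ Fintype.card ι = 1 := by
    rw [← Real.rpow_natCast, ← Real.rpow_natCast, Real.sqrt_eq_rpow, ← Real.rpow_neg (abs_nonneg _),
      ← Real.rpow_mul (abs_nonneg _), ← Real.rpow_mul (abs_nonneg _),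
      ← Real.rpow_add (abs_pos.2 hlam)]
    convert Real.rpow_zero _ using 2
    push_cast; ring
  rw [← mul_assoc, h3, one_mul, Finset.prod_ite_zero]
  simp [funext_iff]

theorem orthonormal_hermiteL2 (lam : ℝ) (hlam : lam ≠ 0) :
    Orthonormal ℂ (hermiteL2 (ι := ι) lam hlam) := by
  classical
  rw [orthonormal_iff_ite]
  intro α β
  rw [inner_hermiteL2_left]
  have : ∫ x, (scaledHermite lam α x : ℂ) * hermiteL2 lam hlam β x =
      ∫ x, ((scaledHermite lam α x * scaledHermite lam β x : ℝ) : ℂ) := by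
    refine integral_congr_ae ?_
    filter_upwards [coeFn_hermiteL2 lam hlam β] with x hx
    rw [hx, Complex.ofReal_mul]
  rw [this, integral_complex_ofReal, integral_scaledHermite_mul lam hlam]
  split_ifs <;> simp

theorem coord_mul_scaledHermite [DecidableEq ι] (lam : ℝ) (hlam : lam ≠ 0) (α : ι → ℕ) (i : ι)
    (x : EuclideanSpace ℝ ι) :
    x i * scaledHermite lam α x = (Real.sqrt 2 * Real.sqrt |lam|)⁻¹ *
      (Real.sqrt (α i + 1) * scaledHermite lam (Function.update α i (α i + 1)) x +
        Real.sqrt (α i) * scaledHermite lam (Function.update α i (α i - 1)) x) := by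
  have ha : Real.sqrt |lam| ≠ 0 := by positivity
  have h2 : Real.sqrt 2 ≠ 0 := by positivity
  have hu : ∀ k, scaledHermite lam (Function.update α i k) x =
      |lam| ^ ((Fintype.card ι : ℝ) / 4) * (hermiteFun k (Real.sqrt |lam| * x i) *
        ∏ j ∈ Finset.univ.erase i, hermiteFun (α j) (Real.sqrt |lam| * x j)) := fun k => by
    rw [scaledHermite, ← Finset.mul_prod_erase Finset.univ _ (Finset.mem_univ i),
      Function.update_self]
    congr 2
    refine Finset.prod_congr rfl fun j hj => ?_
    rw [Function.update_of_ne (Finset.ne_of_mem_erase hj)]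
  have h0 := hu (α i)
  rw [Function.update_eq_self] at h0
  rw [h0, hu, hu, eq_inv_mul_iff_mul_eq₀ (mul_ne_zero h2 ha)]
  linear_combination (|lam| ^ ((Fintype.card ι : ℝ) / 4) *
    ∏ j ∈ Finset.univ.erase i, hermiteFun (α j) (Real.sqrt |lam| * x j)) *
    sqrt_two_mul_hermiteFun (α i) (Real.sqrt |lam| * x i)

/-! ### Completeness of the Hermite functions -/

theorem inner_mul_mem_span_scaledHermite (lam : ℝ) (hlam : lam ≠ 0) (y : EuclideanSpace ℝ ι)
    {G : EuclideanSpace ℝ ι → ℝ} (hG : G ∈ Submodule.span ℝ (Set.range (scaledHermite lam))) :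
    (fun x => inner ℝ y x * G x) ∈ Submodule.span ℝ (Set.range (scaledHermite (ι := ι) lam)) := by
  classical
  induction hG using Submodule.span_induction with
  | mem G hG =>
    obtain ⟨α, rfl⟩ := hG
    have : (fun x : EuclideanSpace ℝ ι => inner ℝ y x * scaledHermite lam α x) =
        ∑ i, (y i * (Real.sqrt 2 * Real.sqrt |lam|)⁻¹) •
          (Real.sqrt (α i + 1) • scaledHermite lam (Function.update α i (α i + 1)) +
        Real.sqrt (α i) • scaledHermite lam (Function.update α i (α i - 1))) := by
      funext x
      simp only [PiLp.inner_apply, Finset.sum_apply, Finset.sum_mul, Pi.smul_apply, Pi.add_apply,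
        smul_eq_mul, RCLike.inner_apply, conj_trivial]
      refine Finset.sum_congr rfl fun i _ => ?_
      rw [mul_comm (x i), mul_assoc, coord_mul_scaledHermite lam hlam, mul_assoc]
    rw [this]
    refine Submodule.sum_mem _ fun i _ => Submodule.smul_mem _ _ (Submodule.add_mem _ ?_ ?_) <;>
      exact Submodule.smul_mem _ _ (Submodule.subset_span ⟨_, rfl⟩)
  | zero =>
    convert Submodule.zero_mem (Submodule.span ℝ (Set.range (scaledHermite (ι := ι) lam))) using 1
    funext x; simp
  | add G H _ _ hG hH =>
    convert Submodule.add_mem _ hG hH using 1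
    funext x; simp only [Pi.add_apply, mul_add]
  | smul c G _ hG =>
    have := Submodule.smul_mem _ c hG
    convert this using 1
    funext x; simp only [Pi.smul_apply, smul_eq_mul]; ring

/-- By the recurrence the span is stable under multiplication by linear forms. These powers are the
terms of the exponential series of `e^{i⟨y,x⟩}` against the Gaussian. -/
theorem inner_pow_mul_mem_span_scaledHermite (lam : ℝ) (hlam : lam ≠ 0) (y : EuclideanSpace ℝ ι)
    (m : ℕ) : (fun x => inner ℝ y x ^ m * scaledHermite lam 0 x) ∈
      Submodule.span ℝ (Set.range (scaledHermite (ι := ι) lam)) := by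
  induction m with
  | zero =>
    simp only [pow_zero, one_mul]
    exact Submodule.subset_span ⟨0, rfl⟩
  | succ m ih =>
    convert inner_mul_mem_span_scaledHermite lam hlam y ih using 1
    funext x; ring

theorem integral_mul_eq_zero_of_mem_span (lam : ℝ) (hlam : lam ≠ 0) (f : L2 ι)
    (hf : ∀ α, inner ℂ (hermiteL2 lam hlam α) f = 0) {G : EuclideanSpace ℝ ι → ℝ}
    (hG : G ∈ Submodule.span ℝ (Set.range (scaledHermite lam))) :
    Integrable (fun x => (G x : ℂ) * f x) ∧ ∫ x, (G x : ℂ) * f x = 0 := by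
  induction hG using Submodule.span_induction with
  | mem G hG =>
    obtain ⟨α, rfl⟩ := hG
    exact ⟨(memLp_scaledHermite lam hlam α).integrable_mul (Lp.memLp f),
      by rw [← inner_hermiteL2_left lam hlam, hf]⟩
  | zero => simp
  | add G H _ _ hG hH =>
    simp only [Pi.add_apply, Complex.ofReal_add, add_mul]
    exact ⟨hG.1.add hH.1, by rw [integral_add hG.1 hH.1, hG.2, hH.2, add_zero]⟩
  | smul c G _ hG =>
    simp only [Pi.smul_apply, smul_eq_mul, Complex.ofReal_mul, mul_assoc]
    exact ⟨hG.1.const_mul _, by rw [integral_const_mul, hG.2, mul_zero]⟩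

theorem scaledHermite_zero (lam : ℝ) (x : EuclideanSpace ℝ ι) :
    scaledHermite lam 0 x = |lam| ^ ((Fintype.card ι : ℝ) / 4) *
      hermiteConst 0 ^ Fintype.card ι * Real.exp (-(|lam| / 2 * ‖x‖ ^ 2)) := by
  simp only [scaledHermite, Pi.zero_apply, hermiteFun_zero]
  rw [Finset.prod_mul_distrib, Finset.prod_const, Finset.card_univ, ← Real.exp_sum, mul_assoc]
  congr 3
  rw [EuclideanSpace.norm_sq_eq, Finset.mul_sum, ← Finset.sum_neg_distrib]
  refine Finset.sum_congr rfl fun i _ => ?_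
  rw [mul_pow, Real.sq_sqrt (abs_nonneg _), Real.norm_eq_abs, sq_abs]
  ring

/-- Supplies the dominating function for termwise integration of that series: `e^{2|s|} ≤ e^{2s} +
e^{-2s}` bounds the square by two Gaussians with linear terms in the exponent. -/
theorem memLp_exp_abs_inner_mul_scaledHermite (lam : ℝ) (hlam : lam ≠ 0)
    (y : EuclideanSpace ℝ ι) :
    MemLp (fun x => Real.exp |inner ℝ y x| * scaledHermite lam 0 x) 2 volume := by
  have hcont : Continuous (fun x => Real.exp |inner ℝ y x| * scaledHermite lam 0 x) := by
    have := continuous_scaledHermite (ι := ι) lam 0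
    fun_prop
  rw [memLp_two_iff_integrable_sq hcont.aestronglyMeasurable]
  have hg : ∀ c : ℝ, Integrable (fun x : EuclideanSpace ℝ ι =>
      Real.exp (-|lam| * ‖x‖ ^ 2 + c * inner ℝ y x)) := fun c => by
    have h := (GaussianFourier.integrable_cexp_neg_mul_sq_norm_add (b := ((|lam| : ℝ) : ℂ))
      (by simpa using hlam) (c : ℂ) y).norm
    refine h.congr (Filter.Eventually.of_forall fun x => ?_)
    simp only [Complex.norm_exp]
    congr 1
    simp [← Complex.ofReal_pow]
  refine (((hg 2).add (hg (-2))).const_mul ((|lam| ^ ((Fintype.card ι : ℝ) / 4) *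
      hermiteConst 0 ^ Fintype.card ι) ^ 2)).mono' (hcont.pow 2).aestronglyMeasurable
    (Filter.Eventually.of_forall fun x => ?_)
  rw [Real.norm_eq_abs, abs_of_nonneg (sq_nonneg _), scaledHermite_zero]
  simp only [Pi.add_apply]
  have e1 : (Real.exp |inner ℝ y x| * (|lam| ^ ((Fintype.card ι : ℝ) / 4) *
      hermiteConst 0 ^ Fintype.card ι * Real.exp (-(|lam| / 2 * ‖x‖ ^ 2)))) ^ 2 =
      (|lam| ^ ((Fintype.card ι : ℝ) / 4) * hermiteConst 0 ^ Fintype.card ι) ^ 2 *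
        (Real.exp (-|lam| * ‖x‖ ^ 2) * Real.exp (2 * |inner ℝ y x|)) := by
    rw [show -|lam| * ‖x‖ ^ 2 = -(|lam| / 2 * ‖x‖ ^ 2) + -(|lam| / 2 * ‖x‖ ^ 2) by ring, two_mul,
      Real.exp_add, Real.exp_add]
    ring
  rw [e1, Real.exp_add, Real.exp_add, ← mul_add]
  gcongr
  rcases abs_cases (inner ℝ y x) with h | h <;> rw [h.1]
  · exact le_add_of_nonneg_right (Real.exp_pos _).le
  · rw [mul_neg, ← neg_mul]; exact le_add_of_nonneg_left (Real.exp_pos _).le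

theorem integral_exp_inner_mul_eq_zero (lam : ℝ) (hlam : lam ≠ 0) (f : L2 ι)
    (hf : ∀ α, inner ℂ (hermiteL2 lam hlam α) f = 0) (y : EuclideanSpace ℝ ι) :
    ∫ x, Complex.exp (Complex.I * (inner ℝ y x : ℝ)) * ((scaledHermite lam 0 x : ℂ) * f x) = 0 := by
  have hterm : ∀ m : ℕ, ∀ x : EuclideanSpace ℝ ι,
      (Complex.I * (inner ℝ y x : ℝ)) ^ m / (m.factorial : ℂ) *
        ((scaledHermite lam 0 x : ℂ) * f x) = Complex.I ^ m / (m.factorial : ℂ) *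
        (((inner ℝ y x ^ m * scaledHermite lam 0 x : ℝ) : ℂ) * f x) := fun m x => by
    push_cast; ring
  have hz := fun m => integral_mul_eq_zero_of_mem_span lam hlam f hf
    (inner_pow_mul_mem_span_scaledHermite lam hlam y m)
  have hs : ∀ r : ℝ, HasSum (fun m : ℕ => r ^ m / (m.factorial : ℝ)) (Real.exp r) := fun r => by
    rw [Real.exp_eq_exp_ℝ]; exact NormedSpace.expSeries_div_hasSum_exp r
  have hsum := hasSum_integral_of_dominated_convergence
    (F := fun (m : ℕ) (x : EuclideanSpace ℝ ι) =>
      (Complex.I * (inner ℝ y x : ℝ)) ^ m / (m.factorial : ℂ) *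
        ((scaledHermite lam 0 x : ℂ) * f x))
    (f := fun x => Complex.exp (Complex.I * (inner ℝ y x : ℝ)) *
      ((scaledHermite lam 0 x : ℂ) * f x)) (μ := volume)
    (fun m x => |inner ℝ y x| ^ m / (m.factorial : ℝ) * (|scaledHermite lam 0 x| * ‖f x‖))
    (fun m => by
      simp only [hterm]
      exact ((hz m).1.const_mul _).1)
    (fun m => Filter.Eventually.of_forall fun x => by
      simp)
    (Filter.Eventually.of_forall fun x => ((hs _).mul_right _).summable)
    (by
      simp only [fun x => ((hs |inner ℝ y x|).mul_right
        (|scaledHermite lam 0 x| * ‖f x‖)).tsum_eq]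
      refine ((memLp_exp_abs_inner_mul_scaledHermite lam hlam y).norm.integrable_mul
        (Lp.memLp f).norm).congr (Filter.Eventually.of_forall fun x => ?_)
      simp [mul_assoc])
    (Filter.Eventually.of_forall fun x => by
      have : HasSum (fun m : ℕ => (Complex.I * (inner ℝ y x : ℝ)) ^ m / (m.factorial : ℂ))
          (Complex.exp (Complex.I * (inner ℝ y x : ℝ))) := by
        rw [Complex.exp_eq_exp_ℂ]; exact NormedSpace.expSeries_div_hasSum_exp _
      exact this.mul_right _)
  have h0 : ∀ m : ℕ, ∫ x : EuclideanSpace ℝ ι,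
      (Complex.I * (inner ℝ y x : ℝ)) ^ m / (m.factorial : ℂ) *
        ((scaledHermite lam 0 x : ℂ) * f x) = 0 := fun m => by
    simp only [hterm]; rw [integral_const_mul, (hz m).2, mul_zero]
  simp only [h0] at hsum
  exact hsum.unique hasSum_zero

open FourierTransform in
/-- An integrable function with vanishing Fourier transform vanishes almost everywhere. -/
theorem ae_eq_zero_of_fourier_eq_zero {V : Type*} [NormedAddCommGroup V] [InnerProductSpace ℝ V]
    [FiniteDimensional ℝ V] [MeasurableSpace V] [BorelSpace V] {f : V → ℂ} (hf : Integrable f)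
    (h : ∀ w, 𝓕 f w = 0) : f =ᵐ[volume] 0 := by
  refine ae_eq_zero_of_integral_contDiff_smul_eq_zero hf.locallyIntegrable fun g hg hc => ?_
  have hg1 : HasCompactSupport (Complex.ofRealCLM ∘ g) := hc.comp_left rfl
  have hg2 : ContDiff ℝ (⊤ : ℕ∞) (Complex.ofRealCLM ∘ g) := by fun_prop
  -- A test function `g` is the Fourier transform of a Schwartz function `ψ`, and moving the
  -- transform across the integral gives `∫ g f = ∫ ψ 𝓕f = 0`.
  set ψ : SchwartzMap V ℂ := 𝓕⁻ (hg1.toSchwartzMap hg2) with hψ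
  have h1 : ∀ x, (g x : ℂ) = 𝓕 (ψ : V → ℂ) x := fun x => by
    rw [← SchwartzMap.fourier_coe, hψ, FourierTransform.fourier_fourierInv_eq]
    rfl
  have h2 := VectorFourier.integral_fourierIntegral_smul_eq_flip (L := innerₗ V)
    Real.continuous_fourierChar continuous_inner ψ.integrable hf (μ := volume) (ν := volume)
  have h3 : ∀ w, VectorFourier.fourierIntegral Real.fourierChar volume (innerₗ V).flip f w = 0 :=
    fun w => by rw [flip_innerₗ]; exact h w
  simp only [h3, smul_zero, integral_zero] at h2
  rw [← h2]
  refine integral_congr_ae (Filter.Eventually.of_forall fun x => ?_)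
  have : VectorFourier.fourierIntegral Real.fourierChar volume (innerₗ V) ψ x = (g x : ℂ) :=
    (h1 x).symm
  simp only [this]
  rw [smul_eq_mul, Complex.real_smul]

open FourierTransform in
-- The product of `f` with the Gaussian is integrable and has zero Fourier transform, and the
-- Gaussian has no zeros.
theorem eq_zero_of_inner_hermiteL2_eq_zero (lam : ℝ) (hlam : lam ≠ 0) (f : L2 ι)
    (hf : ∀ α, inner ℂ (hermiteL2 lam hlam α) f = 0) : f = 0 := by
  have hint : Integrable (fun x => (scaledHermite lam 0 x : ℂ) * f x) :=
    (memLp_scaledHermite lam hlam 0).integrable_mul (Lp.memLp f)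
  have h := ae_eq_zero_of_fourier_eq_zero hint fun w => by
    rw [Real.fourier_eq']
    rw [← integral_exp_inner_mul_eq_zero lam hlam f hf (-(2 * Real.pi) • w)]
    refine integral_congr_ae (Filter.Eventually.of_forall fun x => ?_)
    simp only [smul_eq_mul, inner_smul_left, real_inner_comm x w, conj_trivial]
    congr 2
    push_cast; ring
  rw [Lp.eq_zero_iff_ae_eq_zero]
  filter_upwards [h] with x hx
  refine (mul_eq_zero.1 hx).resolve_left ?_
  rw [scaledHermite_zero]
  have := hermiteConst_pos 0
  have : 0 < |lam| := abs_pos.2 hlam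
  exact_mod_cast (by positivity : |lam| ^ ((Fintype.card ι : ℝ) / 4) *
      hermiteConst 0 ^ Fintype.card ι * Real.exp (-(|lam| / 2 * ‖x‖ ^ 2)) ≠ 0)

/-- The scaled Hermite functions as a Hilbert basis of `L²(ℝ^ι)`. -/
def hermiteBasis (lam : ℝ) (hlam : lam ≠ 0) : HilbertBasis (ι → ℕ) ℂ (L2 ι) :=
  HilbertBasis.mkOfOrthogonalEqBot (orthonormal_hermiteL2 lam hlam) (by
    rw [Submodule.eq_bot_iff]
    intro f hf
    exact eq_zero_of_inner_hermiteL2_eq_zero lam hlam f fun α =>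
      (Submodule.mem_orthogonal _ f).1 hf _ (Submodule.subset_span ⟨α, rfl⟩))

@[simp] theorem coe_hermiteBasis (lam : ℝ) (hlam : lam ≠ 0) :
    ⇑(hermiteBasis (ι := ι) lam hlam) = hermiteL2 lam hlam :=
  HilbertBasis.coe_mkOfOrthogonalEqBot _ _

/-! ### Functions in the Poisson-Hermite space are integrable -/

theorem Orthonormal.summable_smul {κ E : Type*} [NormedAddCommGroup E] [InnerProductSpace ℂ E]
    [CompleteSpace E] {v : κ → E} (hv : Orthonormal ℂ v) {c : κ → ℂ}
    (hc : Summable fun i => ‖c i‖ ^ 2) : Summable fun i => c i • v i := by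
  simpa using (hv.orthogonalFamily.summable_iff_norm_sq_summable c).2 hc

theorem Orthonormal.summable_smul_of_norm_le {κ E : Type*} [NormedAddCommGroup E]
    [InnerProductSpace ℂ E] [CompleteSpace E] {v : κ → E} (hv : Orthonormal ℂ v) {c : κ → ℂ}
    {b : κ → ℝ} (hb : Summable fun i => b i ^ 2) (hcb : ∀ i, ‖c i‖ ≤ b i) :
    Summable fun i => c i • v i :=
  hv.summable_smul (hb.of_nonneg_of_le (fun _ => sq_nonneg _)
    fun i => pow_le_pow_left₀ (norm_nonneg _) (hcb i) 2)

/-- A finite set of multi-indices lies in a box, over which the sum of products factors into a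
product of sums. -/
theorem summable_pi_prod {g : ℕ → ℝ} (h0 : ∀ k, 0 ≤ g k) (hg : Summable g) :
    Summable (fun α : ι → ℕ => ∏ i, g (α i)) := by
  classical
  refine summable_of_sum_le (c := ∏ _i : ι, ∑' k, g k)
    (fun α => Finset.prod_nonneg fun i _ => h0 _) fun s => ?_
  set t : Finset ℕ := s.biUnion fun α => Finset.univ.image α with ht
  have hs : s ⊆ Fintype.piFinset fun _ : ι => t := fun α hα => by
    rw [Fintype.mem_piFinset]
    intro i
    rw [ht, Finset.mem_biUnion]
    exact ⟨α, hα, Finset.mem_image_of_mem _ (Finset.mem_univ i)⟩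
  calc ∑ α ∈ s, ∏ i, g (α i) ≤ ∑ α ∈ Fintype.piFinset fun _ : ι => t, ∏ i, g (α i) :=
        Finset.sum_le_sum_of_subset_of_nonneg hs fun α _ _ => Finset.prod_nonneg fun i _ => h0 _
    _ = ∏ _i : ι, ∑ k ∈ t, g k := (Finset.prod_univ_sum (fun _ => t) fun _ k => g k).symm
    _ ≤ ∏ _i : ι, ∑' k, g k := Finset.prod_le_prod
        (fun i _ => Finset.sum_nonneg fun k _ => h0 k) fun i _ => hg.sum_le_tsum _ fun k _ => h0 k

theorem summable_mul_exp_neg_sqrt (b : ℝ) {c : ℝ} (hc : 0 < c) :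
    Summable (fun k : ℕ => b * (k + 1) * Real.exp (-(c * Real.sqrt k))) := by
  -- The sixth power of `√k` is `k³`; after the linear factor this still leaves the summable `k⁻²`.
  have h := (((isLittleO_pow_exp_pos_mul_atTop 6 hc).comp_tendsto
    (Real.tendsto_sqrt_atTop.comp tendsto_natCast_atTop_atTop)).isBigO)
  refine summable_of_isBigO_nat (Real.summable_one_div_nat_pow.2 one_lt_two) ?_
  have h1 : (fun k : ℕ => Real.exp (-(c * Real.sqrt k))) =O[Filter.atTop]
      fun k : ℕ => ((k : ℝ) ^ 3)⁻¹ := by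
    have h2 := h.inv_rev ?_
    · refine (h2.congr (fun k => ?_) fun k => ?_)
      · simp [Real.exp_neg]
      · simp only [Function.comp_apply]
        rw [show 6 = 2 * 3 from rfl, pow_mul, Real.sq_sqrt (Nat.cast_nonneg _)]
    · filter_upwards [Filter.eventually_gt_atTop 0] with k hk h
      exfalso
      simp only [Function.comp_apply] at h
      have : 0 < Real.sqrt k := Real.sqrt_pos.2 (by exact_mod_cast hk)
      exact (pow_pos this 6).ne' h
  have h3 : (fun k : ℕ => b * ((k : ℝ) + 1)) =O[Filter.atTop] fun k : ℕ => (k : ℝ) := by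
    refine (Asymptotics.IsBigO.of_bound 2 ?_).const_mul_left b
    filter_upwards [Filter.eventually_ge_atTop 1] with k hk
    have : (1 : ℝ) ≤ k := by exact_mod_cast hk
    rw [Real.norm_of_nonneg (by positivity), Real.norm_of_nonneg (by positivity)]
    linarith
  refine (h3.mul h1).congr' Filter.EventuallyEq.rfl ?_
  filter_upwards [Filter.eventually_gt_atTop 0] with k hk
  have : (k : ℝ) ≠ 0 := by exact_mod_cast hk.ne'
  field_simp

/-- Each `√(α_i |λ|)` is at most the root of the eigenvalue; averaging over the `d` coordinates
gives a bound that factors over the coordinates. -/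
theorem exp_neg_sqrt_hermiteEigenvalue_le {t : ℝ} (ht : 0 < t) (lam : ℝ) (α : ι → ℕ) :
    Real.exp (-(t * Real.sqrt (hermiteEigenvalue lam α))) ≤
      ∏ i, Real.exp (-(t * Real.sqrt |lam| / Fintype.card ι * Real.sqrt (α i))) := by
  rw [← Real.exp_sum, Real.exp_le_exp, Finset.sum_neg_distrib, neg_le_neg_iff, ← Finset.mul_sum]
  have h1 : ∀ i, Real.sqrt (α i) * Real.sqrt |lam| ≤ Real.sqrt (hermiteEigenvalue lam α) :=
    fun i => by
      rw [← Real.sqrt_mul (Nat.cast_nonneg _)]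
      refine Real.sqrt_le_sqrt (mul_le_mul_of_nonneg_right ?_ (abs_nonneg _))
      have := Finset.single_le_sum (f := fun i => (α i : ℝ)) (fun i _ => Nat.cast_nonneg _)
        (Finset.mem_univ i)
      have h2 : (0 : ℝ) ≤ ∑ i, (α i : ℝ) := Finset.sum_nonneg fun i _ => Nat.cast_nonneg _
      have h3 : (0 : ℝ) ≤ Fintype.card ι := Nat.cast_nonneg _
      linarith
  have h2 := Finset.sum_le_sum fun i (_ : i ∈ Finset.univ) => h1 i
  rw [← Finset.sum_mul, Finset.sum_const, Finset.card_univ, nsmul_eq_mul] at h2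
  -- In dimension zero the division by `d` has the default value `0`, and the bound is still true.
  rcases (Nat.cast_nonneg (α := ℝ) (Fintype.card ι)).eq_or_lt with h | h
  · rw [← h]; simp; positivity
  · rw [mul_div_assoc, mul_assoc, div_mul_eq_mul_div]
    refine mul_le_mul_of_nonneg_left ?_ ht.le
    rw [div_le_iff₀ h]
    linarith

theorem integrable_scaledHermite (lam : ℝ) (hlam : lam ≠ 0) (α : ι → ℕ) :
    Integrable (fun x => (scaledHermite lam α x : ℂ)) := by
  have ha : Real.sqrt |lam| ≠ 0 := by positivity
  exact ((integrable_euclideanSpace_prod (f := fun i s => hermiteFun (α i) (Real.sqrt |lam| * s))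
    fun i => (integrable_hermiteFun (α i)).comp_mul_left' ha).const_mul _).ofReal

theorem integral_norm_scaledHermite_le (lam : ℝ) (hlam : lam ≠ 0) (α : ι → ℕ) :
    ∫ x, ‖(scaledHermite lam α x : ℂ)‖ ≤ |lam| ^ ((Fintype.card ι : ℝ) / 4) *
      ∏ i, ((Real.sqrt |lam|)⁻¹ * 3 * (α i + 1)) := by
  have ha : 0 < Real.sqrt |lam| := by positivity
  have h1 : ∀ x : EuclideanSpace ℝ ι, ‖(scaledHermite lam α x : ℂ)‖ =
      |lam| ^ ((Fintype.card ι : ℝ) / 4) * ∏ i, |hermiteFun (α i) (Real.sqrt |lam| * x i)| :=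
    fun x => by
      rw [Complex.norm_real, Real.norm_eq_abs, scaledHermite, abs_mul, Finset.abs_prod,
        abs_of_nonneg (by positivity)]
  simp only [h1]
  rw [integral_const_mul, integral_euclideanSpace_prod fun i s =>
    |hermiteFun (α i) (Real.sqrt |lam| * s)|]
  refine mul_le_mul_of_nonneg_left (Finset.prod_le_prod
    (fun i _ => integral_nonneg fun _ => abs_nonneg _) fun i _ => ?_) (by positivity)
  rw [Measure.integral_comp_mul_left (fun s => |hermiteFun (α i) s|), abs_of_pos (inv_pos.2 ha),
    smul_eq_mul, mul_assoc]
  exact mul_le_mul_of_nonneg_left (integral_abs_hermiteFun_le _) (by positivity)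

/-- Decay `e^{-c√|α|}` of the coefficients beats polynomial growth of the `L¹` norms, so the Hermite
series of `F` also converges absolutely in `L¹`. -/
theorem integrable_of_isPoissonHermite {t : ℝ} (ht : 0 < t) (lam : ℝ) (hlam : lam ≠ 0)
    {g F : L2 ι} (h : IsPoissonHermite t lam hlam g F) : Integrable F := by
  set c : (ι → ℕ) → ℂ := fun α => (Real.exp (-(t * Real.sqrt (hermiteEigenvalue lam α))) : ℂ) *
      inner ℂ (hermiteL2 lam hlam α) g with hc
  set Φ : (ι → ℕ) → Lp ℂ 1 (volume : Measure (EuclideanSpace ℝ ι)) :=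
    fun α => (integrable_scaledHermite lam hlam α).toL1 _ with hΦ
  have hcg : ∀ α, ‖c α‖ ≤ (∏ i, Real.exp (-(t * Real.sqrt |lam| / Fintype.card ι *
      Real.sqrt (α i)))) * ‖g‖ := fun α => by
    rw [hc, norm_mul, Complex.norm_real, Real.norm_eq_abs, Real.abs_exp]
    refine mul_le_mul (exp_neg_sqrt_hermiteEigenvalue_le ht lam α) ?_ (norm_nonneg _)
      (Finset.prod_nonneg fun i _ => (Real.exp_pos _).le)
    refine (norm_inner_le_norm _ _).trans ?_
    rw [(orthonormal_hermiteL2 lam hlam).1, one_mul]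
  have hsum : Summable fun α => c α • Φ α := by
    by_cases hι : Fintype.card ι = 0
    · have : IsEmpty ι := Fintype.card_eq_zero_iff.1 hι
      exact (hasSum_fintype _).summable
    have hcard : 0 < (Fintype.card ι : ℝ) := by exact_mod_cast Nat.pos_of_ne_zero hι
    have hlam' : 0 < Real.sqrt |lam| := by positivity
    refine Summable.of_norm_bounded ((summable_pi_prod (ι := ι)
      (g := fun k : ℕ => (Real.sqrt |lam|)⁻¹ * 3 * (k + 1) * Real.exp (-(t * Real.sqrt |lam| /
        Fintype.card ι * Real.sqrt k))) (fun k => by positivity)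
      (summable_mul_exp_neg_sqrt _ (by positivity))).mul_left
        (‖g‖ * |lam| ^ ((Fintype.card ι : ℝ) / 4))) fun α => ?_
    have hn : ‖Φ α‖ ≤ |lam| ^ ((Fintype.card ι : ℝ) / 4) *
        ∏ i, ((Real.sqrt |lam|)⁻¹ * 3 * (α i + 1)) := by
      rw [L1.norm_eq_integral_norm]
      refine le_of_eq_of_le (integral_congr_ae ?_) (integral_norm_scaledHermite_le lam hlam α)
      filter_upwards [(integrable_scaledHermite lam hlam α).coeFn_toL1] with x hx
      rw [hx]
    rw [norm_smul]
    refine (mul_le_mul (hcg α) hn (norm_nonneg _) (mul_nonneg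
      (Finset.prod_nonneg fun i _ => (Real.exp_pos _).le) (norm_nonneg _))).trans (le_of_eq ?_)
    rw [Finset.prod_mul_distrib (f := fun i => (Real.sqrt |lam|)⁻¹ * 3 * ((α i : ℝ) + 1))]
    ring
  have hL1 := hsum.hasSum
  -- The same partial sums converge in `L¹` and in `L²`, hence in measure to both limits, which
  -- therefore agree almost everywhere.
  have hm1 := tendstoInMeasure_of_tendsto_Lp hL1
  have hm2 := tendstoInMeasure_of_tendsto_Lp h
  have hEq : ∀ s : Finset (ι → ℕ), (∑ α ∈ s, c α • Φ α : Lp ℂ 1 volume) =ᵐ[volume]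
      (∑ α ∈ s, c α • hermiteL2 lam hlam α : L2 ι) := fun s => by
    refine (Lp.coeFn_fun_finsetSum s _).trans
      (Filter.EventuallyEq.trans ?_ (Lp.coeFn_fun_finsetSum s _).symm)
    have h1 : ∀ α : ι → ℕ, (c α • Φ α : Lp ℂ 1 volume) =ᵐ[volume]
        (c α • hermiteL2 lam hlam α : L2 ι) := fun α => by
      filter_upwards [Lp.coeFn_smul (c α) (Φ α), Lp.coeFn_smul (c α) (hermiteL2 lam hlam α),
        (integrable_scaledHermite lam hlam α).coeFn_toL1, coeFn_hermiteL2 lam hlam α]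
        with x h1 h2 h3 h4
      rw [h1, h2, Pi.smul_apply, Pi.smul_apply, h4]
      exact congrArg (c α • ·) h3
    filter_upwards [ae_all_iff.2 h1] with x hx
    exact Finset.sum_congr rfl fun α _ => hx α
  have hae := tendstoInMeasure_ae_unique (hm1.congr_left hEq) hm2
  exact (L1.integrable_coeFn _).congr hae

/-! ### Fourier-Wigner transforms of Hermite functions -/

/-- The matrix coefficient `(π(x,u) h_k, h_j)` of the Schrödinger representation on `L²(ℝ)`. -/
def fourierWigner (j k : ℕ) (x u : ℝ) : ℂ :=
  ∫ ξ : ℝ, (hermiteFun j ξ : ℂ) *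
    (Complex.exp (Complex.I * ((x * ξ + 1 / 2 * (x * u) : ℝ) : ℂ)) * (hermiteFun k (ξ + u) : ℂ))

/-- The coefficients of a product of two Hermite functions in variables rotated by 45 degrees. -/
def hermiteRotation (j k : ℕ) : ℕ × ℕ → ℝ := Classical.choose (exists_hermiteFun_rotation j k)

theorem hermiteFun_mul_eq_rotation (j k : ℕ) (y w : ℝ) :
    hermiteFun k y * hermiteFun j w =
      ∑ p ∈ Finset.HasAntidiagonal.antidiagonal (j + k), hermiteRotation j k p *
      (hermiteFun p.1 ((y + w) / Real.sqrt 2) * hermiteFun p.2 ((y - w) / Real.sqrt 2)) :=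
  Classical.choose_spec (exists_hermiteFun_rotation j k) y w

/-- The two-variable Hermite function `h_a(x/√2) h_b(u/√2)`. -/
def hermiteFun₂ (p : ℕ × ℕ) (x u : ℝ) : ℝ :=
  hermiteFun p.1 (x / Real.sqrt 2) * hermiteFun p.2 (u / Real.sqrt 2)

/-- With `ξ = s - u/2` the phase becomes `e^{ixs}` and the two Hermite functions are evaluated at `s
± u/2`. The rotation separates `√2 s` from `u/√2`, and the `s`-integral is the Fourier transform of
one Hermite function. The Jacobian `1/√2` turns `√(2π)` into `√π`. -/
theorem fourierWigner_eq (j k : ℕ) (x u : ℝ) :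
    fourierWigner j k x u = ∑ p ∈ Finset.HasAntidiagonal.antidiagonal (j + k),
      (hermiteRotation j k p : ℂ) * (Real.sqrt Real.pi : ℂ) * Complex.I ^ p.1 *
        (hermiteFun₂ p x u : ℂ) := by
  have h2 : 0 < Real.sqrt 2 := by positivity
  have hs : Real.sqrt 2 * Real.sqrt 2 = 2 := Real.mul_self_sqrt (by norm_num)
  set G : ℕ → ℝ → ℂ := fun a s => Complex.exp (Complex.I * ((x / Real.sqrt 2 * s : ℝ) : ℂ)) *
      (hermiteFun a s : ℂ) with hG
  have hint : ∀ a, Integrable (fun s => G a (Real.sqrt 2 * s)) := fun a =>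
    (integrable_exp_mul_hermiteFun a _).comp_mul_left' h2.ne'
  rw [fourierWigner, ← integral_sub_right_eq_self _ (u / 2)]
  have h1 : ∀ s : ℝ, (hermiteFun j (s - u / 2) : ℂ) *
      (Complex.exp (Complex.I * ((x * (s - u / 2) + 1 / 2 * (x * u) : ℝ) : ℂ)) *
        (hermiteFun k (s - u / 2 + u) : ℂ)) =
      ∑ p ∈ Finset.HasAntidiagonal.antidiagonal (j + k),
        ((hermiteRotation j k p : ℂ) * (hermiteFun p.2 (u / Real.sqrt 2) : ℂ)) *
          G p.1 (Real.sqrt 2 * s) := fun s => by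
    have h := hermiteFun_mul_eq_rotation j k (s - u / 2 + u) (s - u / 2)
    have e1 : (s - u / 2 + u + (s - u / 2)) / Real.sqrt 2 = Real.sqrt 2 * s := by
      rw [div_eq_iff h2.ne']; linear_combination -s * hs
    have e2 : (s - u / 2 + u - (s - u / 2)) / Real.sqrt 2 = u / Real.sqrt 2 := by ring
    have e3 : x * (s - u / 2) + 1 / 2 * (x * u) = x / Real.sqrt 2 * (Real.sqrt 2 * s) := by
      field_simp; ring
    rw [e1, e2] at h
    have h' := congrArg (fun r : ℝ => (r : ℂ)) h
    simp only [Complex.ofReal_mul, Complex.ofReal_sum] at h'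
    rw [e3]
    calc _ = Complex.exp (Complex.I * ((x / Real.sqrt 2 * (Real.sqrt 2 * s) : ℝ) : ℂ)) *
        ((hermiteFun k (s - u / 2 + u) : ℂ) * (hermiteFun j (s - u / 2) : ℂ)) := by ring
      _ = _ := by
        rw [h', Finset.mul_sum]
        refine Finset.sum_congr rfl fun p _ => ?_
        simp only [hG]; ring
  simp only [h1]
  rw [integral_finsetSum _ fun p _ => (hint p.1).const_mul _]
  refine Finset.sum_congr rfl fun p _ => ?_
  rw [integral_const_mul, Measure.integral_comp_mul_left (G p.1), integral_exp_mul_hermiteFun,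
    abs_of_pos (inv_pos.2 h2), Real.sqrt_mul (by norm_num), Complex.real_smul, hermiteFun₂]
  have hc : (Real.sqrt 2 : ℂ) ≠ 0 := by exact_mod_cast h2.ne'
  push_cast
  field_simp

theorem continuous_hermiteFun₂ (p : ℕ × ℕ) :
    Continuous (fun z : ℝ × ℝ => hermiteFun₂ p z.1 z.2) := by
  unfold hermiteFun₂
  have h1 := continuous_hermiteFun p.1
  have h2 := continuous_hermiteFun p.2
  fun_prop

theorem continuous_fourierWigner (j k : ℕ) :
    Continuous (fun z : ℝ × ℝ => fourierWigner j k z.1 z.2) := by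
  simp only [fourierWigner_eq]
  refine continuous_finsetSum _ fun p _ => ?_
  have := continuous_hermiteFun₂ p
  fun_prop

theorem integrable_hermiteFun₂_mul (p q : ℕ × ℕ) :
    Integrable (fun z : ℝ × ℝ => hermiteFun₂ p z.1 z.2 * hermiteFun₂ q z.1 z.2) := by
  have h2 : Real.sqrt 2 ≠ 0 := by positivity
  have h := ((integrable_hermiteFun_mul p.1 q.1).comp_div h2).mul_prod
    ((integrable_hermiteFun_mul p.2 q.2).comp_div h2)
  refine h.congr (Filter.Eventually.of_forall fun z => ?_)
  simp only [hermiteFun₂]; ring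

theorem integral_hermiteFun₂_mul (p q : ℕ × ℕ) :
    ∫ z : ℝ × ℝ, hermiteFun₂ p z.1 z.2 * hermiteFun₂ q z.1 z.2 = if p = q then 2 else 0 := by
  refine ((integral_congr_ae (Filter.Eventually.of_forall fun z => ?_)).trans (integral_prod_mul
    (fun x => hermiteFun p.1 (x / Real.sqrt 2) * hermiteFun q.1 (x / Real.sqrt 2))
    (fun x => hermiteFun p.2 (x / Real.sqrt 2) * hermiteFun q.2 (x / Real.sqrt 2)))).trans ?_
  · simp only [hermiteFun₂]; ring
  rw [Measure.integral_comp_div (fun x => hermiteFun p.1 x * hermiteFun q.1 x),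
    Measure.integral_comp_div (fun x => hermiteFun p.2 x * hermiteFun q.2 x),
    integral_hermiteFun_mul, integral_hermiteFun_mul, abs_of_pos (by positivity)]
  have hs : Real.sqrt 2 * Real.sqrt 2 = 2 := Real.mul_self_sqrt (by norm_num)
  by_cases h1 : p.1 = q.1 <;> by_cases h2 : p.2 = q.2 <;> simp [h1, h2, Prod.ext_iff]

theorem measurePreserving_rotation : MeasurePreserving
    (fun z : ℝ × ℝ => ((z.1 + z.2) / Real.sqrt 2, (z.1 - z.2) / Real.sqrt 2)) := by
  set r := (Real.sqrt 2)⁻¹ with hr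
  have hr2 : r * r = 1 / 2 := by
    rw [hr, ← mul_inv, Real.mul_self_sqrt (by norm_num)]; norm_num
  set T : ℝ × ℝ →ₗ[ℝ] ℝ × ℝ := Matrix.toLin (Module.Basis.finTwoProd ℝ) (Module.Basis.finTwoProd ℝ)
    !![r, r; r, -r] with hT
  have hdet : LinearMap.det T = -1 := by
    rw [hT, LinearMap.det_toLin, Matrix.det_fin_two_of]; linarith
  have hTe : (fun z : ℝ × ℝ => ((z.1 + z.2) / Real.sqrt 2, (z.1 - z.2) / Real.sqrt 2)) = T := by
    funext z
    rw [hT, Matrix.toLin_finTwoProd_apply]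
    ext <;> simp only [hr] <;> ring
  rw [hTe]
  refine ⟨T.continuous_of_finiteDimensional.measurable, ?_⟩
  rw [Measure.map_linearMap_addHaar_eq_smul_addHaar volume (by rw [hdet]; norm_num), hdet]
  simp

/-- The products of Hermite functions are orthonormal in `L²(ℝ²)`, and so are their rotated copies
since the rotation preserves measure. Hence the expansion coefficients have orthonormal rows, with
no formula for them needed. -/
theorem sum_hermiteRotation_mul (j k j' k' : ℕ) :
    ∑ p ∈ Finset.HasAntidiagonal.antidiagonal (j + k),
      ∑ q ∈ Finset.HasAntidiagonal.antidiagonal (j' + k'),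
        hermiteRotation j k p * hermiteRotation j' k' q * (if p = q then 1 else 0) =
      if j = j' ∧ k = k' then 1 else 0 := by
  set E : ℕ × ℕ → ℝ × ℝ → ℝ := fun p z => hermiteFun p.1 z.1 * hermiteFun p.2 z.2 with hE
  have hEc : ∀ p, Continuous (E p) := fun p => by
    have h1 := continuous_hermiteFun p.1
    have h2 := continuous_hermiteFun p.2
    fun_prop
  have hEi : ∀ p q, Integrable (fun z => E p z * E q z) := fun p q =>
    ((integrable_hermiteFun_mul p.1 q.1).mul_prod (integrable_hermiteFun_mul p.2 q.2)).congr
      (Filter.Eventually.of_forall fun z => by simp only [hE]; ring)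
  have hEE : ∀ p q, ∫ z, E p z * E q z = if p = q then 1 else 0 := fun p q => by
    refine ((integral_congr_ae (Filter.Eventually.of_forall fun z => ?_)).trans (integral_prod_mul
      (fun x => hermiteFun p.1 x * hermiteFun q.1 x)
      (fun x => hermiteFun p.2 x * hermiteFun q.2 x))).trans ?_
    · simp only [hE]; ring
    rw [integral_hermiteFun_mul, integral_hermiteFun_mul]
    by_cases h1 : p.1 = q.1 <;> by_cases h2 : p.2 = q.2 <;> simp [h1, h2, Prod.ext_iff]
  have hrot : ∀ (j k : ℕ) (z : ℝ × ℝ), E (k, j) z =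
      ∑ p ∈ Finset.HasAntidiagonal.antidiagonal (j + k), hermiteRotation j k p *
        E p ((z.1 + z.2) / Real.sqrt 2, (z.1 - z.2) / Real.sqrt 2) := fun j k z =>
    hermiteFun_mul_eq_rotation j k z.1 z.2
  have hmap : ∀ p q, ∫ z : ℝ × ℝ, E p ((z.1 + z.2) / Real.sqrt 2, (z.1 - z.2) / Real.sqrt 2) *
      E q ((z.1 + z.2) / Real.sqrt 2, (z.1 - z.2) / Real.sqrt 2) = if p = q then 1 else 0 :=
    fun p q => by
      rw [← hEE]
      conv_rhs => rw [← measurePreserving_rotation.map_eq]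
      exact (integral_map measurePreserving_rotation.aemeasurable
        ((hEc p).mul (hEc q)).aestronglyMeasurable).symm
  have hmapi : ∀ p q, Integrable (fun z : ℝ × ℝ =>
      E p ((z.1 + z.2) / Real.sqrt 2, (z.1 - z.2) / Real.sqrt 2) *
      E q ((z.1 + z.2) / Real.sqrt 2, (z.1 - z.2) / Real.sqrt 2)) := fun p q =>
    measurePreserving_rotation.integrable_comp_of_integrable (hEi p q)
  have h := hEE (k, j) (k', j')
  simp only [hrot j k, hrot j' k', Finset.sum_mul_sum] at h
  simp only [mul_mul_mul_comm] at h
  rw [integral_finsetSum _ fun p _ => integrable_finsetSum _ fun q _ =>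
    (hmapi p q).const_mul _] at h
  simp only [integral_finsetSum _ fun q _ => (hmapi _ q).const_mul _, integral_const_mul,
    hmap] at h
  rw [h]
  simp only [Prod.mk.injEq, and_comm]

theorem integrable_fourierWigner_mul (j k : ℕ) (q : ℕ × ℕ) :
    Integrable (fun z : ℝ × ℝ => fourierWigner j k z.1 z.2 * (hermiteFun₂ q z.1 z.2 : ℂ)) := by
  simp only [fourierWigner_eq, Finset.sum_mul, mul_assoc]
  refine integrable_finsetSum _ fun p _ => ?_
  refine (((integrable_hermiteFun₂_mul p q).ofReal (𝕜 := ℂ)).const_mul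
    ((hermiteRotation j k p : ℂ) * (Real.sqrt Real.pi : ℂ) * Complex.I ^ p.1)).congr
    (Filter.Eventually.of_forall fun z => ?_)
  simp only [RCLike.ofReal_mul, mul_assoc]
  rfl

theorem integral_fourierWigner_mul (j k : ℕ) (q : ℕ × ℕ) :
    ∫ z : ℝ × ℝ, fourierWigner j k z.1 z.2 * (hermiteFun₂ q z.1 z.2 : ℂ) =
      ∑ p ∈ Finset.HasAntidiagonal.antidiagonal (j + k),
        (hermiteRotation j k p : ℂ) * (Real.sqrt Real.pi : ℂ) * Complex.I ^ p.1 *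
          (if p = q then 2 else 0) := by
  have hi : ∀ p, Integrable (fun z : ℝ × ℝ =>
      ((hermiteFun₂ p z.1 z.2 * hermiteFun₂ q z.1 z.2 : ℝ) : ℂ)) := fun p =>
    (integrable_hermiteFun₂_mul p q).ofReal
  simp only [fourierWigner_eq, Finset.sum_mul, mul_assoc _ (Complex.ofReal (hermiteFun₂ _ _ _)),
    ← Complex.ofReal_mul (hermiteFun₂ _ _ _)]
  rw [integral_finsetSum _ fun p _ => (hi p).const_mul _]
  refine Finset.sum_congr rfl fun p _ => ?_
  rw [integral_const_mul, integral_complex_ofReal, integral_hermiteFun₂_mul]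
  split_ifs <;> simp

theorem integral_fourierWigner_mul_eq_zero {j k : ℕ} {q : ℕ × ℕ} (h : q.1 + q.2 ≠ j + k) :
    ∫ z : ℝ × ℝ, fourierWigner j k z.1 z.2 * (hermiteFun₂ q z.1 z.2 : ℂ) = 0 := by
  rw [integral_fourierWigner_mul]
  refine Finset.sum_eq_zero fun p hp => ?_
  rw [if_neg, mul_zero]
  rintro rfl
  exact h (Finset.HasAntidiagonal.mem_antidiagonal.1 hp)

theorem fourierWigner_mul_conj_eq (j k j' k' : ℕ) (z : ℝ × ℝ) :
    fourierWigner j k z.1 z.2 * (starRingEnd ℂ) (fourierWigner j' k' z.1 z.2) =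
      ∑ q ∈ Finset.HasAntidiagonal.antidiagonal (j' + k'),
        (starRingEnd ℂ) ((hermiteRotation j' k' q : ℂ) * (Real.sqrt Real.pi : ℂ) *
          Complex.I ^ q.1) * (fourierWigner j k z.1 z.2 * (hermiteFun₂ q z.1 z.2 : ℂ)) := by
  rw [fourierWigner_eq j' k', map_sum, Finset.mul_sum]
  refine Finset.sum_congr rfl fun q _ => ?_
  rw [map_mul _ _ (Complex.ofReal (hermiteFun₂ _ _ _)), Complex.conj_ofReal]
  ring

theorem integrable_fourierWigner_mul_conj (j k j' k' : ℕ) :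
    Integrable (fun z : ℝ × ℝ =>
      fourierWigner j k z.1 z.2 * (starRingEnd ℂ) (fourierWigner j' k' z.1 z.2)) := by
  simp only [fourierWigner_mul_conj_eq]
  exact integrable_finsetSum _ fun q _ => (integrable_fourierWigner_mul j k q).const_mul _

/-- Moyal's identity for Hermite functions. -/
theorem integral_fourierWigner_mul_conj (j k j' k' : ℕ) :
    ∫ z : ℝ × ℝ, fourierWigner j k z.1 z.2 * (starRingEnd ℂ) (fourierWigner j' k' z.1 z.2) =
      if j = j' ∧ k = k' then 2 * (Real.pi : ℂ) else 0 := by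
  simp only [fourierWigner_mul_conj_eq]
  rw [integral_finsetSum _ fun q _ => (integrable_fourierWigner_mul j k q).const_mul _]
  simp only [integral_const_mul, integral_fourierWigner_mul, Finset.mul_sum]
  rw [Finset.sum_comm]
  have h := congrArg (fun r : ℝ => (2 * Real.pi : ℂ) * (r : ℂ)) (sum_hermiteRotation_mul j k j' k')
  have h2 : (2 * Real.pi : ℂ) * ((if j = j' ∧ k = k' then 1 else 0 : ℝ) : ℂ) =
      if j = j' ∧ k = k' then 2 * (Real.pi : ℂ) else 0 := by split_ifs <;> simp
  rw [← h2]
  refine Eq.trans ?_ h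
  simp only [Complex.ofReal_sum, Finset.mul_sum]
  refine Finset.sum_congr rfl fun p _ => Finset.sum_congr rfl fun q _ => ?_
  -- On the diagonal the phases `I^p.1` cancel against their conjugates, and `2 · √π · √π` gives the
  -- constant.
  by_cases hpq : p = q
  · subst hpq
    have hI : (starRingEnd ℂ) (Complex.I ^ p.1) * Complex.I ^ p.1 = 1 := by
      rw [map_pow, ← mul_pow, Complex.conj_I, neg_mul, Complex.I_mul_I, neg_neg, one_pow]
    have hpi : (Real.sqrt Real.pi : ℂ) * (Real.sqrt Real.pi : ℂ) = (Real.pi : ℂ) := by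
      rw [← Complex.ofReal_mul, Real.mul_self_sqrt Real.pi_pos.le]
    simp only [if_true, map_mul, Complex.conj_ofReal, Complex.ofReal_mul, Complex.ofReal_one]
    linear_combination (2 * (hermiteRotation j k p : ℂ) * (hermiteRotation j' k' p : ℂ) *
      (Real.sqrt Real.pi : ℂ) * (Real.sqrt Real.pi : ℂ)) * hI +
      (2 * (hermiteRotation j k p : ℂ) * (hermiteRotation j' k' p : ℂ)) * hpi
  · simp [hpq]

/-! ### Fourier-Wigner transforms on `ℝ^{2n}` -/

/-- Pairing the two halves of the coordinates of `ℝ^{2ι}`. -/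
def pairCoords (ι : Type) : EuclideanSpace ℝ (ι ⊕ ι) ≃ᵐ (ι → ℝ × ℝ) :=
  ((MeasurableEquiv.toLp 2 (ι ⊕ ι → ℝ)).symm.trans
    (MeasurableEquiv.sumPiEquivProdPi fun _ : ι ⊕ ι => ℝ)).trans
      (MeasurableEquiv.arrowProdEquivProdArrow ℝ ℝ ι).symm

theorem measurePreserving_pairCoords : MeasurePreserving (pairCoords ι) :=
  ((EuclideanSpace.volume_preserving_symm_measurableEquiv_toLp (ι ⊕ ι)).trans
    (volume_measurePreserving_sumPiEquivProdPi fun _ : ι ⊕ ι => ℝ)).trans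
      (volume_measurePreserving_arrowProdEquivProdArrow ℝ ℝ ι).symm

theorem integral_prod_pairs {𝕜 : Type*} [RCLike 𝕜] (G : ι → ℝ × ℝ → 𝕜) :
    ∫ p : EuclideanSpace ℝ (ι ⊕ ι), ∏ i, G i (p (Sum.inl i), p (Sum.inr i)) =
      ∏ i, ∫ z, G i z := by
  rw [← integral_fintype_prod_volume_eq_prod]
  exact measurePreserving_pairCoords.integral_comp' (fun z : ι → ℝ × ℝ => ∏ i, G i (z i))

theorem integrable_prod_pairs {𝕜 : Type*} [RCLike 𝕜] {G : ι → ℝ × ℝ → 𝕜}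
    (hG : ∀ i, Integrable (G i)) :
    Integrable fun p : EuclideanSpace ℝ (ι ⊕ ι) => ∏ i, G i (p (Sum.inl i), p (Sum.inr i)) :=
  (measurePreserving_pairCoords.integrable_comp_emb
    (MeasurableEquiv.measurableEmbedding _)).2 (Integrable.fintype_prod hG)

/-- The matrix coefficient `(π(x,u) Φ_k, Φ_j)` as a function of `(x, u)`. -/
def fourierWignerPi (j k : ι → ℕ) (p : EuclideanSpace ℝ (ι ⊕ ι)) : ℂ :=
  ∏ i, fourierWigner (j i) (k i) (p (Sum.inl i)) (p (Sum.inr i))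

theorem continuous_fourierWignerPi (j k : ι → ℕ) : Continuous (fourierWignerPi j k) := by
  unfold fourierWignerPi
  refine continuous_finsetProd _ fun i _ =>
    (continuous_fourierWigner (j i) (k i)).comp (g := fun z : ℝ × ℝ => _)
      (f := fun p : EuclideanSpace ℝ (ι ⊕ ι) => (p (Sum.inl i), p (Sum.inr i))) ?_
  fun_prop

theorem fourierWignerPi_mul_conj (j k j' k' : ι → ℕ) (p : EuclideanSpace ℝ (ι ⊕ ι)) :
    fourierWignerPi j k p * (starRingEnd ℂ) (fourierWignerPi j' k' p) =
      ∏ i, (fun z : ℝ × ℝ => fourierWigner (j i) (k i) z.1 z.2 *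
        (starRingEnd ℂ) (fourierWigner (j' i) (k' i) z.1 z.2)) (p (Sum.inl i), p (Sum.inr i)) := by
  rw [fourierWignerPi, fourierWignerPi, map_prod, ← Finset.prod_mul_distrib]

theorem memLp_conj_fourierWignerPi (j k : ι → ℕ) :
    MemLp (fun p => (starRingEnd ℂ) (fourierWignerPi j k p)) 2 volume := by
  refine (memLp_two_iff_integrable_sq_norm (Complex.continuous_conj.comp
    (continuous_fourierWignerPi j k)).aestronglyMeasurable).2 ?_
  refine (integrable_prod_pairs fun i =>
    integrable_fourierWigner_mul_conj (j i) (k i) (j i) (k i)).norm.congr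
      (Filter.Eventually.of_forall fun p => ?_)
  simp only [← fourierWignerPi_mul_conj, Function.comp_apply, norm_mul, RCLike.norm_conj, sq]

/-- The complex conjugate of the matrix coefficient `(π(x,u) Φ_k, Φ_j)` in `L²(ℝ^{2ι})`. -/
def conjFourierWigner (j k : ι → ℕ) : L2 (ι ⊕ ι) := (memLp_conj_fourierWignerPi j k).toLp _

/-- The inner product is conjugate-linear on the left; starting from the conjugate makes the pairing
with `f` the unconjugated integral of the Weyl transform. -/
theorem inner_conjFourierWigner_left (j k : ι → ℕ) (f : L2 (ι ⊕ ι)) :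
    inner ℂ (conjFourierWigner j k) f = ∫ p, fourierWignerPi j k p * f p := by
  rw [L2.inner_def]
  refine integral_congr_ae ?_
  filter_upwards [(memLp_conj_fourierWignerPi j k).coeFn_toLp] with p hp
  rw [conjFourierWigner, hp, RCLike.inner_apply, Complex.conj_conj, mul_comm]

theorem inner_conjFourierWigner (j k j' k' : ι → ℕ) :
    inner ℂ (conjFourierWigner j k) (conjFourierWigner j' k') =
      if j = j' ∧ k = k' then (2 * (Real.pi : ℂ)) ^ Fintype.card ι else 0 := by
  have h : inner ℂ (conjFourierWigner j k) (conjFourierWigner j' k') =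
      ∫ p, fourierWignerPi j k p * (starRingEnd ℂ) (fourierWignerPi j' k' p) := by
    rw [inner_conjFourierWigner_left]
    refine integral_congr_ae ?_
    filter_upwards [(memLp_conj_fourierWignerPi j' k').coeFn_toLp] with p hp
    rw [conjFourierWigner, hp]
  simp only [h, fourierWignerPi_mul_conj]
  refine (integral_prod_pairs fun i z => fourierWigner (j i) (k i) z.1 z.2 *
    (starRingEnd ℂ) (fourierWigner (j' i) (k' i) z.1 z.2)).trans ?_
  simp only [integral_fourierWigner_mul_conj]
  rw [Finset.prod_ite_zero]
  simp only [Finset.mem_univ, forall_true_left, Finset.prod_const, Finset.card_univ, forall_and,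
    funext_iff]

/-- This is where `λ = 1/2` enters: its scaling is the dilation by `1/√2` in `hermiteFun₂`. -/
theorem sqrt_abs_half_mul (x : ℝ) : Real.sqrt |(1 / 2 : ℝ)| * x = x / Real.sqrt 2 := by
  rw [abs_of_pos (by norm_num), Real.sqrt_div zero_le_one, Real.sqrt_one]; ring

/-- The Fourier-Wigner transform of Hermite functions is an eigenfunction of `H(1/2)`. -/
theorem inner_conjFourierWigner_hermiteL2 (j k : ι → ℕ) (α : ι ⊕ ι → ℕ)
    (h : ∑ i, α i ≠ ∑ i, j i + ∑ i, k i) :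
    inner ℂ (conjFourierWigner j k) (hermiteL2 (1 / 2) (by norm_num) α) = 0 := by
  have h1 : inner ℂ (conjFourierWigner j k) (hermiteL2 (1 / 2) (by norm_num) α) =
      ∫ p, fourierWignerPi j k p * (scaledHermite (1 / 2) α p : ℂ) := by
    rw [inner_conjFourierWigner_left]
    refine integral_congr_ae ?_
    filter_upwards [coeFn_hermiteL2 (1 / 2) (by norm_num) α] with p hp
    rw [hp]
  have h2 : ∀ p, fourierWignerPi j k p * (scaledHermite (1 / 2) α p : ℂ) =
      ((|(1 / 2 : ℝ)| ^ ((Fintype.card (ι ⊕ ι) : ℝ) / 4) : ℝ) : ℂ) *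
      ∏ i, (fun z : ℝ × ℝ => fourierWigner (j i) (k i) z.1 z.2 *
        (hermiteFun₂ (α (Sum.inl i), α (Sum.inr i)) z.1 z.2 : ℂ))
          (p (Sum.inl i), p (Sum.inr i)) := fun p => by
    simp only [fourierWignerPi, scaledHermite, hermiteFun₂, Fintype.prod_sum_type,
      sqrt_abs_half_mul, Complex.ofReal_mul, Complex.ofReal_prod, Finset.prod_mul_distrib]
    ring
  rw [h1]
  simp only [h2]
  rw [integral_const_mul]
  have h4 := integral_prod_pairs fun i z => fourierWigner (j i) (k i) z.1 z.2 *
    (hermiteFun₂ (α (Sum.inl i), α (Sum.inr i)) z.1 z.2 : ℂ)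
  -- A mismatch of total degrees forces one in some pair of coordinates, and that factor of the
  -- integral vanishes.
  have h3 : ∃ i, α (Sum.inl i) + α (Sum.inr i) ≠ j i + k i := by
    by_contra! hc
    refine h ?_
    rw [Fintype.sum_sum_type, ← Finset.sum_add_distrib, ← Finset.sum_add_distrib]
    exact Finset.sum_congr rfl fun i _ => hc i
  obtain ⟨i, hi⟩ := h3
  rw [Finset.prod_eq_zero (Finset.mem_univ i) (integral_fourierWigner_mul_eq_zero hi)] at h4
  exact mul_eq_zero_of_right _ h4

/-- The eigenvalue of `H(1/2)` on `ℝ^{2ι}` at `conjFourierWigner j k`. -/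
def weylEigenvalue (j k : ι → ℕ) : ℝ := ∑ i, (j i : ℝ) + ∑ i, (k i : ℝ) + Fintype.card ι

theorem hermiteEigenvalue_half (j k : ι → ℕ) (α : ι ⊕ ι → ℕ)
    (h : ∑ i, α i = ∑ i, j i + ∑ i, k i) :
    hermiteEigenvalue (1 / 2) α = weylEigenvalue j k := by
  have h' : ∑ i, (α i : ℝ) = ∑ i, (j i : ℝ) + ∑ i, (k i : ℝ) := by exact_mod_cast h
  rw [hermiteEigenvalue, weylEigenvalue, h', abs_of_pos (by norm_num), Fintype.card_sum]
  push_cast; ring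

/-- The action of `e^{-t √H(1/2)}` on the coefficients along `conjFourierWigner`. -/
theorem inner_conjFourierWigner_of_isPoissonHermite {t : ℝ} {g F : L2 (ι ⊕ ι)}
    (h : IsPoissonHermite t (1 / 2) (by norm_num) g F) (j k : ι → ℕ) :
    inner ℂ (conjFourierWigner j k) F =
      (Real.exp (-(t * Real.sqrt (weylEigenvalue j k))) : ℂ) *
        inner ℂ (conjFourierWigner j k) g := by
  have h1 := h.mapL (innerSL ℂ (conjFourierWigner j k))
  have h2 := ((hermiteBasis (ι := ι ⊕ ι) (1 / 2) (by norm_num)).hasSum_inner_mul_inner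
    (conjFourierWigner j k) g).mul_left (Real.exp (-(t * Real.sqrt (weylEigenvalue j k))) : ℂ)
  refine h1.unique (h2.congr_fun fun α => ?_)
  simp only [coe_hermiteBasis, innerSL_apply_apply, inner_smul_right]
  -- Only multi-indices with `|α| = |j| + |k|` pair nontrivially, and on that layer the multiplier
  -- is constant.
  by_cases hα : ∑ i, α i = ∑ i, j i + ∑ i, k i
  · rw [hermiteEigenvalue_half j k α hα]; ring
  · rw [inner_conjFourierWigner_hermiteL2 j k α hα]; simp

/-- The normalised family of conjugate Fourier-Wigner transforms is orthonormal. -/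
theorem orthonormal_conjFourierWigner : Orthonormal ℂ (fun jk : (ι → ℕ) × (ι → ℕ) =>
    ((Real.sqrt ((2 * Real.pi) ^ Fintype.card ι))⁻¹ : ℂ) • conjFourierWigner jk.1 jk.2) := by
  classical
  rw [orthonormal_iff_ite]
  rintro ⟨j, k⟩ ⟨j', k'⟩
  have hr : Real.sqrt ((2 * Real.pi) ^ Fintype.card ι) *
    Real.sqrt ((2 * Real.pi) ^ Fintype.card ι) = (2 * Real.pi) ^ Fintype.card ι :=
      Real.mul_self_sqrt (by positivity)
  have hr0 : Real.sqrt ((2 * Real.pi) ^ Fintype.card ι) ≠ 0 := by positivity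
  have hc : (Real.sqrt ((2 * Real.pi) ^ Fintype.card ι) : ℂ) ≠ 0 := by exact_mod_cast hr0
  have hrc : (2 * (Real.pi : ℂ)) ^ Fintype.card ι = (Real.sqrt ((2 * Real.pi) ^ Fintype.card ι) : ℂ) *
      (Real.sqrt ((2 * Real.pi) ^ Fintype.card ι) : ℂ) := by
    rw [← Complex.ofReal_mul, hr]; push_cast; rfl
  rw [inner_smul_left, inner_smul_right, inner_conjFourierWigner, map_inv₀, Complex.conj_ofReal]
  by_cases h : j = j' ∧ k = k'
  · rw [if_pos h, if_pos (by rw [h.1, h.2]), hrc]; field_simp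
  · rw [if_neg h, if_neg (by simpa [Prod.ext_iff] using h)]; simp

/-! ### The Schrödinger representation -/

variable {n : ℕ}

theorem coeFn_schrodinger (x u : EuclideanSpace ℝ (Fin n)) (φ : L2 (Fin n)) :
    schrodinger x u φ =ᵐ[volume] fun ξ =>
      Complex.exp (Complex.I * ((inner ℝ x ξ + 1 / 2 * inner ℝ x u : ℝ) : ℂ)) * φ (ξ + u) :=
  MemLp.coeFn_toLp _

theorem ae_add_right (u : EuclideanSpace ℝ (Fin n)) {P : EuclideanSpace ℝ (Fin n) → Prop}
    (h : ∀ᵐ ξ, P ξ) : ∀ᵐ ξ, P (ξ + u) :=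
  (measurePreserving_add_right volume u).quasiMeasurePreserving.ae h

theorem schrodinger_add (x u : EuclideanSpace ℝ (Fin n)) (φ ψ : L2 (Fin n)) :
    schrodinger x u (φ + ψ) = schrodinger x u φ + schrodinger x u ψ := by
  refine Lp.ext ?_
  filter_upwards [coeFn_schrodinger x u (φ + ψ), coeFn_schrodinger x u φ, coeFn_schrodinger x u ψ,
    Lp.coeFn_add (schrodinger x u φ) (schrodinger x u ψ), ae_add_right u (Lp.coeFn_add φ ψ)]
    with ξ h1 h2 h3 h4 h5
  rw [h1, h4, Pi.add_apply, h2, h3, h5, Pi.add_apply, mul_add]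

theorem schrodinger_smul (x u : EuclideanSpace ℝ (Fin n)) (c : ℂ) (φ : L2 (Fin n)) :
    schrodinger x u (c • φ) = c • schrodinger x u φ := by
  refine Lp.ext ?_
  filter_upwards [coeFn_schrodinger x u (c • φ), coeFn_schrodinger x u φ,
    Lp.coeFn_smul c (schrodinger x u φ), ae_add_right u (Lp.coeFn_smul c φ)]
    with ξ h1 h2 h3 h4
  rw [h1, h3, Pi.smul_apply, h2, h4, Pi.smul_apply, smul_eq_mul, smul_eq_mul]
  ring

theorem norm_schrodinger (x u : EuclideanSpace ℝ (Fin n)) (φ : L2 (Fin n)) :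
    ‖schrodinger x u φ‖ = ‖φ‖ := by
  rw [Lp.norm_def, Lp.norm_def, eLpNorm_congr_ae (coeFn_schrodinger x u φ)]
  congr 1
  rw [← eLpNorm_comp_measurePreserving (Lp.aestronglyMeasurable φ)
    (measurePreserving_add_right volume u)]
  refine eLpNorm_congr_norm_ae (Filter.Eventually.of_forall fun ξ => ?_)
  rw [norm_mul, mul_comm Complex.I, Complex.norm_exp_ofReal_mul_I, one_mul]
  rfl

/-- The Schrödinger representation acts by linear isometries. -/
def schrodingerIsometry (x u : EuclideanSpace ℝ (Fin n)) : L2 (Fin n) →ₗᵢ[ℂ] L2 (Fin n) where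
  toFun := schrodinger x u
  map_add' := schrodinger_add x u
  map_smul' := schrodinger_smul x u
  norm_map' := norm_schrodinger x u

theorem scaledHermite_one (α : ι → ℕ) (x : EuclideanSpace ℝ ι) :
    scaledHermite 1 α x = ∏ i, hermiteFun (α i) (x i) := by
  simp [scaledHermite]

theorem inner_hermiteL2_schrodinger (j k : Fin n → ℕ) (p : EuclideanSpace ℝ (Fin n ⊕ Fin n)) :
    inner ℂ (hermiteL2 1 one_ne_zero j)
      (schrodinger (fstHalf p) (sndHalf p) (hermiteL2 1 one_ne_zero k)) =
      fourierWignerPi j k p := by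
  rw [inner_hermiteL2_left, fourierWignerPi]
  simp only [fourierWigner]
  rw [← integral_euclideanSpace_prod]
  refine integral_congr_ae ?_
  filter_upwards [coeFn_schrodinger (fstHalf p) (sndHalf p) (hermiteL2 1 one_ne_zero k),
    ae_add_right (sndHalf p) (coeFn_hermiteL2 1 one_ne_zero k)] with ξ h1 h2
  rw [h1, h2, scaledHermite_one, scaledHermite_one]
  simp only [Finset.prod_mul_distrib, ← Complex.exp_sum, ← Finset.mul_sum, ← Complex.ofReal_sum,
    Complex.ofReal_prod]
  congr 4
  · simp [PiLp.inner_apply, fstHalf, sndHalf, Finset.sum_add_distrib, Finset.mul_sum, mul_comm]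

/-- Matrix entries between Hermite functions are continuous in `(x,u)`. Expanding first `φ` and then
`π(x,u)φ` in the Hermite basis exhibits the map as an iterated pointwise limit of strongly
measurable ones. -/
theorem stronglyMeasurable_schrodinger (φ : L2 (Fin n)) :
    StronglyMeasurable fun p : EuclideanSpace ℝ (Fin n ⊕ Fin n) =>
      schrodinger (fstHalf p) (sndHalf p) φ := by
  have h1 : ∀ j, StronglyMeasurable fun p : EuclideanSpace ℝ (Fin n ⊕ Fin n) =>
      inner ℂ (hermiteL2 1 one_ne_zero j) (schrodinger (fstHalf p) (sndHalf p) φ) := fun j => by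
    refine stronglyMeasurable_of_tendsto (f := fun (s : Finset (Fin n → ℕ)) p =>
      ∑ k ∈ s, inner ℂ (hermiteL2 1 one_ne_zero k) φ * fourierWignerPi j k p) Filter.atTop
      (fun s => (continuous_finsetSum _ fun k _ =>
        continuous_const.mul (continuous_fourierWignerPi j k)).stronglyMeasurable) ?_
    rw [tendsto_pi_nhds]
    intro p
    have h := ((hermiteBasis 1 one_ne_zero).hasSum_repr φ).mapL
      ((innerSL ℂ (hermiteL2 1 one_ne_zero j)).comp
        (schrodingerIsometry (fstHalf p) (sndHalf p)).toContinuousLinearMap)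
    refine h.congr_fun fun k => ?_
    rw [map_smul, HilbertBasis.repr_apply_apply, coe_hermiteBasis, smul_eq_mul]
    exact congrArg _ (inner_hermiteL2_schrodinger j k p).symm
  refine stronglyMeasurable_of_tendsto (f := fun (s : Finset (Fin n → ℕ)) p =>
    ∑ j ∈ s, inner ℂ (hermiteL2 1 one_ne_zero j) (schrodinger (fstHalf p) (sndHalf p) φ) •
      hermiteL2 1 one_ne_zero j) Filter.atTop
    (fun s => Finset.stronglyMeasurable_fun_sum s fun j _ => (h1 j).smul_const _) ?_
  rw [tendsto_pi_nhds]
  intro p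
  have h := (hermiteBasis 1 one_ne_zero).hasSum_repr (schrodinger (fstHalf p) (sndHalf p) φ)
  refine h.congr_fun fun k => ?_
  rw [HilbertBasis.repr_apply_apply, coe_hermiteBasis]

/-! ### The Weyl transform -/

theorem integrable_weylIntegrand {F : L2 (Fin n ⊕ Fin n)} (hF : Integrable F) (φ : L2 (Fin n)) :
    Integrable (weylIntegrand F φ) := by
  refine (hF.norm.mul_const ‖φ‖).mono'
    (hF.1.smul (stronglyMeasurable_schrodinger φ).aestronglyMeasurable)
    (Filter.Eventually.of_forall fun p => ?_)
  rw [weylIntegrand, norm_smul, norm_schrodinger]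

/-- The Weyl transform of an integrable function as a bounded operator. -/
def weylOperator {F : L2 (Fin n ⊕ Fin n)} (hF : Integrable F) : L2 (Fin n) →L[ℂ] L2 (Fin n) :=
  LinearMap.mkContinuous
    { toFun := weylTransform F
      map_add' := fun φ ψ => by
        rw [weylTransform, weylTransform, weylTransform,
          ← integral_add (integrable_weylIntegrand hF φ) (integrable_weylIntegrand hF ψ)]
        simp only [weylIntegrand, schrodinger_add, smul_add]
      map_smul' := fun c φ => by
        rw [weylTransform, weylTransform, RingHom.id_apply, ← integral_smul]
        simp only [weylIntegrand, schrodinger_smul, smul_comm c] }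
    (∫ p, ‖F p‖) fun φ => by
      refine (norm_integral_le_integral_norm _).trans (le_of_eq ?_)
      simp only [weylIntegrand, norm_smul, norm_schrodinger]
      rw [integral_mul_const]

/-- The bridge between the two sides: the inner product passes under the Bochner integral. -/
theorem inner_weylTransform_hermiteL2 {F : L2 (Fin n ⊕ Fin n)} (hF : Integrable F)
    (j k : Fin n → ℕ) :
    inner ℂ (hermiteL2 1 one_ne_zero j) (weylTransform F (hermiteL2 1 one_ne_zero k)) =
      inner ℂ (conjFourierWigner j k) F := by
  rw [weylTransform, ← integral_inner (integrable_weylIntegrand hF _),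
    inner_conjFourierWigner_left]
  simp only [weylIntegrand, inner_smul_right, inner_hermiteL2_schrodinger, mul_comm]

theorem hasSum_inner_weylTransform {F : L2 (Fin n ⊕ Fin n)} (hF : Integrable F)
    (j : Fin n → ℕ) (φ : L2 (Fin n)) :
    HasSum (fun k => inner ℂ (hermiteL2 1 one_ne_zero k) φ * inner ℂ (conjFourierWigner j k) F)
      (inner ℂ (hermiteL2 1 one_ne_zero j) (weylTransform F φ)) := by
  have h := ((hermiteBasis 1 one_ne_zero).hasSum_repr φ).mapL
    ((innerSL ℂ (hermiteL2 1 one_ne_zero j)).comp (weylOperator hF))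
  refine h.congr_fun fun k => ?_
  rw [map_smul, HilbertBasis.repr_apply_apply, coe_hermiteBasis, smul_eq_mul]
  exact congrArg _ (inner_weylTransform_hermiteL2 hF j k).symm

/-! ### The image of the Weyl transform -/

theorem Orthonormal.inner_eq_of_hasSum {κ E : Type*} [NormedAddCommGroup E]
    [InnerProductSpace ℂ E] {v : κ → E} (hv : Orthonormal ℂ v) {c : κ → ℂ} {g : E}
    (hg : HasSum (fun i => c i • v i) g) (i : κ) : inner ℂ (v i) g = c i := by
  classical
  have h := hg.mapL (innerSL ℂ (v i))
  refine h.unique ?_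
  have h1 : ∀ j, innerSL ℂ (v i) (c j • v j) = if i = j then c j else 0 := fun j => by
    rw [innerSL_apply_apply, inner_smul_right, orthonormal_iff_ite.1 hv i j, mul_ite, mul_one,
      mul_zero]
  simpa [h1] using hasSum_single (f := fun j => if i = j then c j else 0) i
    (fun j hj => if_neg hj.symm)

theorem isPoissonHermite_of_inner_eq {t lam : ℝ} (hlam : lam ≠ 0) {g f : L2 ι}
    (h : ∀ α, inner ℂ (hermiteL2 lam hlam α) f =
      (Real.exp (-(t * Real.sqrt (hermiteEigenvalue lam α))) : ℂ) *
        inner ℂ (hermiteL2 lam hlam α) g) : IsPoissonHermite t lam hlam g f := by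
  have h1 := (hermiteBasis lam hlam).hasSum_repr f
  refine h1.congr_fun fun α => ?_
  rw [HilbertBasis.repr_apply_apply, coe_hermiteBasis, h]

theorem IsPoissonHermite.inner_eq {t lam : ℝ} {hlam : lam ≠ 0} {g f : L2 ι}
    (h : IsPoissonHermite t lam hlam g f) (α : ι → ℕ) :
    inner ℂ (hermiteL2 lam hlam α) f =
      (Real.exp (-(t * Real.sqrt (hermiteEigenvalue lam α))) : ℂ) *
        inner ℂ (hermiteL2 lam hlam α) g :=
  (orthonormal_hermiteL2 lam hlam).inner_eq_of_hasSum h α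

theorem exists_isPoissonHermite {t : ℝ} (ht : 0 ≤ t) {lam : ℝ} (hlam : lam ≠ 0) (g : L2 ι) :
    ∃ f, IsPoissonHermite t lam hlam g f := by
  have hv := orthonormal_hermiteL2 (ι := ι) lam hlam
  refine ⟨_, (hv.summable_smul_of_norm_le (hv.inner_products_summable g) fun α => ?_).hasSum⟩
  rw [norm_mul, Complex.norm_real, Real.norm_eq_abs, Real.abs_exp]
  exact mul_le_of_le_one_left (norm_nonneg _) (Real.exp_le_one_iff.2
    (neg_nonpos.2 (mul_nonneg ht (Real.sqrt_nonneg _))))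

theorem norm_sq_le_tsum_mul_tsum {κ : Type*} {a b : κ → ℂ} {S : ℂ}
    (h : HasSum (fun k => a k * b k) S) (ha : Summable fun k => ‖a k‖ ^ 2)
    (hb : Summable fun k => ‖b k‖ ^ 2) :
    ‖S‖ ^ 2 ≤ (∑' k, ‖a k‖ ^ 2) * ∑' k, ‖b k‖ ^ 2 := by
  refine le_of_tendsto (h.norm.pow 2) (Filter.Eventually.of_forall fun s => ?_)
  calc ‖∑ k ∈ s, a k * b k‖ ^ 2 ≤ (∑ k ∈ s, ‖a k‖ * ‖b k‖) ^ 2 :=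
        pow_le_pow_left₀ (norm_nonneg _)
          ((norm_sum_le _ _).trans_eq (by simp only [norm_mul])) 2
    _ ≤ (∑ k ∈ s, ‖a k‖ ^ 2) * ∑ k ∈ s, ‖b k‖ ^ 2 := Finset.sum_mul_sq_le_sq_mul_sq _ _ _
    _ ≤ _ := mul_le_mul (ha.sum_le_tsum _ fun _ _ => sq_nonneg _)
        (hb.sum_le_tsum _ fun _ _ => sq_nonneg _) (Finset.sum_nonneg fun _ _ => sq_nonneg _)
        (tsum_nonneg fun _ => sq_nonneg _)

/-- Bessel's inequality after normalisation; completeness of the Fourier-Wigner family is not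
needed. -/
theorem summable_inner_conjFourierWigner_sq (g : L2 (ι ⊕ ι)) :
    Summable fun jk : (ι → ℕ) × (ι → ℕ) => ‖inner ℂ (conjFourierWigner jk.1 jk.2) g‖ ^ 2 := by
  have h := (orthonormal_conjFourierWigner (ι := ι)).inner_products_summable g
  have hr : Real.sqrt ((2 * Real.pi) ^ Fintype.card ι) ≠ 0 := by positivity
  refine (h.mul_left (Real.sqrt ((2 * Real.pi) ^ Fintype.card ι) ^ 2)).congr fun jk => ?_
  rw [inner_smul_left, norm_mul, RCLike.norm_conj, norm_inv, Complex.norm_real,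
    Real.norm_eq_abs, abs_of_nonneg (Real.sqrt_nonneg _), ← mul_pow, mul_inv_cancel_left₀ hr]

/-- The factor `√2` in the time is explained by `2(|j|+|k|+n) = (2|j|+n) + (2|k|+n)`. -/
theorem sqrt_two_mul_sqrt_weylEigenvalue (j k : ι → ℕ) :
    Real.sqrt 2 * Real.sqrt (weylEigenvalue j k) = Real.sqrt (hermiteEigenvalue 1 j +
      (2 * ∑ i, (k i : ℝ) + Fintype.card ι)) := by
  rw [← Real.sqrt_mul zero_le_two]
  congr 1
  rw [weylEigenvalue, hermiteEigenvalue, abs_one]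
  ring

theorem sqrt_hermiteEigenvalue_le (j k : ι → ℕ) :
    Real.sqrt (hermiteEigenvalue 1 j) ≤ Real.sqrt 2 * Real.sqrt (weylEigenvalue j k) := by
  rw [sqrt_two_mul_sqrt_weylEigenvalue]
  refine Real.sqrt_le_sqrt (le_add_of_nonneg_right ?_)
  positivity

/-- Subadditivity of the square root: along `k = 0` the two decay rates differ by a bounded amount.
-/
theorem sqrt_weylEigenvalue_zero_le (j : ι → ℕ) :
    Real.sqrt 2 * Real.sqrt (weylEigenvalue j 0) ≤
      Real.sqrt (hermiteEigenvalue 1 j) + Real.sqrt (Fintype.card ι) := by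
  rw [sqrt_two_mul_sqrt_weylEigenvalue]
  simp only [Pi.zero_apply, Nat.cast_zero, Finset.sum_const_zero, mul_zero, zero_add]
  have h1 : 0 ≤ hermiteEigenvalue 1 j := by rw [hermiteEigenvalue]; positivity
  have h2 : (0 : ℝ) ≤ Fintype.card ι := Nat.cast_nonneg _
  refine Real.sqrt_le_iff.2 ⟨by positivity, ?_⟩
  rw [add_sq, Real.sq_sqrt h1, Real.sq_sqrt h2]
  have := mul_nonneg (Real.sqrt_nonneg (hermiteEigenvalue 1 j))
    (Real.sqrt_nonneg (Fintype.card ι : ℝ))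
  linarith

theorem weylTransform_mem_poissonHermiteSpace {t : ℝ} (ht : 0 < t) {g F : L2 (Fin n ⊕ Fin n)}
    (h : IsPoissonHermite (Real.sqrt 2 * t) (1 / 2) (by norm_num) g F) (φ : L2 (Fin n)) :
    weylTransform F φ ∈ poissonHermiteSpace (Fin n) t 1 one_ne_zero := by
  have hF : Integrable F := integrable_of_isPoissonHermite (by positivity) _ _ h
  have hv := orthonormal_hermiteL2 (ι := Fin n) 1 one_ne_zero
  set e : (Fin n → ℕ) → ℝ := fun j => Real.exp (t * Real.sqrt (hermiteEigenvalue 1 j)) with he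
  -- These are the coefficients a preimage under `e^{-t√H}` must have; the task is their square
  -- summability.
  set c : (Fin n → ℕ) → ℂ := fun j =>
    (e j : ℂ) * inner ℂ (hermiteL2 1 one_ne_zero j) (weylTransform F φ) with hc
  have hd := summable_inner_conjFourierWigner_sq g
  have hcle : ∀ j, ‖c j‖ ^ 2 ≤ (∑' k, ‖inner ℂ (hermiteL2 1 one_ne_zero k) φ‖ ^ 2) *
      ∑' k, ‖inner ℂ (conjFourierWigner j k) g‖ ^ 2 := fun j => by
    have hdj : Summable fun k => ‖inner ℂ (conjFourierWigner j k) g‖ ^ 2 := hd.prod_factor j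
    have h1 := (hasSum_inner_weylTransform hF j φ).mul_left (e j : ℂ)
    simp only [mul_left_comm (e j : ℂ)] at h1
    have hle : ∀ k, ‖(e j : ℂ) * inner ℂ (conjFourierWigner j k) F‖ ^ 2 ≤
        ‖inner ℂ (conjFourierWigner j k) g‖ ^ 2 := fun k => by
      refine pow_le_pow_left₀ (norm_nonneg _) ?_ 2
      rw [inner_conjFourierWigner_of_isPoissonHermite h, ← mul_assoc, ← Complex.ofReal_mul, he,
        ← Real.exp_add, norm_mul, Complex.norm_real, Real.norm_eq_abs, Real.abs_exp]
      refine mul_le_of_le_one_left (norm_nonneg _) (Real.exp_le_one_iff.2 ?_)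
      have := mul_le_mul_of_nonneg_left (sqrt_hermiteEigenvalue_le j k) ht.le
      linarith
    have hs := hdj.of_nonneg_of_le (fun _ => sq_nonneg _) hle
    refine (norm_sq_le_tsum_mul_tsum h1 (hv.inner_products_summable φ) hs).trans ?_
    exact mul_le_mul_of_nonneg_left (hs.tsum_le_tsum hle hdj) (tsum_nonneg fun _ => sq_nonneg _)
  have hcs : Summable fun j => ‖c j‖ ^ 2 :=
    (hd.prod.mul_left _).of_nonneg_of_le (fun _ => sq_nonneg _) hcle
  refine ⟨_, isPoissonHermite_of_inner_eq one_ne_zero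
    (g := ∑' j, c j • hermiteL2 1 one_ne_zero j) fun j => ?_⟩
  rw [hv.inner_eq_of_hasSum (hv.summable_smul hcs).hasSum, hc, ← mul_assoc, ← Complex.ofReal_mul,
    he, ← Real.exp_add, neg_add_cancel, Real.exp_zero, Complex.ofReal_one, one_mul]

theorem exists_weylTransform_eq {t : ℝ} (ht : 0 < t) {g ψ : L2 (Fin n)}
    (h : IsPoissonHermite t 1 one_ne_zero g ψ) :
    ∃ F ∈ poissonHermiteSpace (Fin n ⊕ Fin n) (Real.sqrt 2 * t) (1 / 2) (by norm_num),
      ∃ φ : L2 (Fin n), weylTransform F φ = ψ := by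
  set r : ℝ := Real.sqrt ((2 * Real.pi) ^ Fintype.card (Fin n)) with hr
  have hr0 : r ≠ 0 := by positivity
  have hrc : (r : ℂ) ≠ 0 := by exact_mod_cast hr0
  have hv := orthonormal_hermiteL2 (ι := Fin n) 1 one_ne_zero
  have hw := (orthonormal_conjFourierWigner (ι := Fin n)).comp (fun j => (j, 0))
    (fun _ _ h => congrArg Prod.fst h)
  -- The ratio of the desired decay to the decay forced on the entry `(j,0)`; it is bounded, so the
  -- corrected coefficients `b` still define an `L²` function.
  set ρ : (Fin n → ℕ) → ℝ := fun j => Real.exp (Real.sqrt 2 * t * Real.sqrt (weylEigenvalue j 0) -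
    t * Real.sqrt (hermiteEigenvalue 1 j)) with hρ
  have hρle : ∀ j, ρ j ≤ Real.exp (t * Real.sqrt (Fintype.card (Fin n))) := fun j => by
    rw [hρ, Real.exp_le_exp]
    have := mul_le_mul_of_nonneg_left (sqrt_weylEigenvalue_zero_le j) ht.le
    linarith
  set b : (Fin n → ℕ) → ℂ := fun j =>
    ((r⁻¹ * ρ j : ℝ) : ℂ) * inner ℂ (hermiteL2 1 one_ne_zero j) g with hb
  have hbs := hw.summable_smul_of_norm_le (c := b)
    (b := fun j => r⁻¹ * Real.exp (t * Real.sqrt (Fintype.card (Fin n))) *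
      ‖inner ℂ (hermiteL2 1 one_ne_zero j) g‖)
    (by simpa only [mul_pow] using (hv.inner_products_summable g).mul_left _) fun j => by
      rw [hb, norm_mul, Complex.norm_real, Real.norm_eq_abs, abs_of_nonneg (by positivity)]
      have : 0 ≤ r⁻¹ := by positivity
      gcongr
      exact hρle j
  obtain ⟨F, hF⟩ := exists_isPoissonHermite (t := Real.sqrt 2 * t) (by positivity)
    (lam := 1 / 2) (by norm_num) (∑' j, b j • ((fun jk : (Fin n → ℕ) × (Fin n → ℕ) =>
      (r⁻¹ : ℂ) • conjFourierWigner jk.1 jk.2) ∘ fun j => (j, 0)) j)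
  have hFi : Integrable F := integrable_of_isPoissonHermite (by positivity) _ _ hF
  -- Applied to the ground state, `W(F)` sees only the column `k = 0`, which was prescribed to match
  -- the coefficients of `ψ`.
  refine ⟨F, ⟨_, hF⟩, hermiteL2 1 one_ne_zero 0, ?_⟩
  rw [← sub_eq_zero]
  refine eq_zero_of_inner_hermiteL2_eq_zero 1 one_ne_zero _ fun j => ?_
  have h1 := hw.inner_eq_of_hasSum hbs.hasSum j
  rw [Function.comp_apply, inner_smul_left, map_inv₀, Complex.conj_ofReal,
    inv_mul_eq_iff_eq_mul₀ hrc] at h1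
  rw [inner_sub_right, inner_weylTransform_hermiteL2 hFi,
    inner_conjFourierWigner_of_isPoissonHermite hF, h.inner_eq, sub_eq_zero]
  refine (congrArg _ h1).trans ?_
  rw [hb, ← mul_assoc, ← mul_assoc, ← Complex.ofReal_mul, ← Complex.ofReal_mul]
  congr 2
  rw [mul_assoc, mul_inv_cancel_left₀ hr0, hρ, ← Real.exp_add]
  congr 1; ring

end

theorem theorem3p4 (n : ℕ) (t : ℝ) (ht : 0 < t) :
    (∀ F ∈ poissonHermiteSpace (Fin n ⊕ Fin n) (Real.sqrt 2 * t) (1 / 2) (by norm_num),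
      ∀ φ : L2 (Fin n), Integrable (weylIntegrand F φ)) ∧
    {ψ : L2 (Fin n) |
      ∃ F ∈ poissonHermiteSpace (Fin n ⊕ Fin n) (Real.sqrt 2 * t) (1 / 2) (by norm_num),
        ∃ φ : L2 (Fin n), weylTransform F φ = ψ} =
      poissonHermiteSpace (Fin n) t 1 one_ne_zero := by
  refine ⟨fun F ⟨g, hF⟩ φ => integrable_weylIntegrand
    (integrable_of_isPoissonHermite (by positivity) _ _ hF) φ, Set.Subset.antisymm ?_ ?_⟩
  · rintro _ ⟨F, ⟨g, hF⟩, φ, rfl⟩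
    exact weylTransform_mem_poissonHermiteSpace ht hF φ
  · rintro ψ ⟨g, hg⟩
    exact exists_weylTransform_eq ht hg
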